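/- Let $p$ be a prime, $s\ge 1$, $W=W(\overline{\mathbb F}_p)$, $K=\operatorname{Frac}W$ (with $|p|_p=p^{-1}$), and let $\underline a=(a_1,\dots,a_s)\in(\mathbb Q\cap\mathbb Z_p)^s$, $\underline b=(b_1,\dots,b_{s-1})\in\big((\mathbb Q\cap\mathbb Z_p)\setminus\mathbb Z_{\le 0}\big)^{s-1}$. For $\alpha\in\mathbb Z_p$ let $\alpha'=(\alpha+l)/p$, where $l\in\{0,\dots,p-1\}$ and $\alpha+l\equiv 0 \pmod p$; put $\alpha^{(0)}=\alpha$, $\alpha^{(i+1)}=(\alpha^{(i)})'$, and write $\alpha=-\sum_{n\ge 0}[\alpha]_n p^n$ with $[\alpha]_n\in\{0,\dots,p-1\}$. Let $q$ be the number of $j$ with $b_j\ne 1$, and assume: (i) $|b_j^{(i)}|_p=1$ for all $i\ge 0$ and all $j$ with $b_j\neq 1$; (ii) for each $n\ge 0$, once the indices are rearranged (depending on $n$) so that $[a_1]_n\le\dots\le[a_s]_n$ and $[b_1]_n\le\dots\le[b_{s-1}]_n$, one has $[a_{j+1}]_n<[b_j]_n$ for $j=1,\dots,q$. With $(\alpha)_n=\alpha(\alpha+1)\cdots(\alpha+n-1)$,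 put $$F^{(i)}_{\underline a,\underline b}(t)=\sum_{n\ge 0}\frac{(a_1^{(i)})_n\cdots(a_s^{(i)})_n}{(b_1^{(i)})_n\cdots(b_{s-1}^{(i)})_n\,(1)_n}\,t^n,\qquad F_{\underline a,\underline b}=F^{(0)}_{\underline a,\underline b}.$$ Let $\log$ be the Iwasawa logarithm, $\gamma_p=\lim_{m\to\infty}p^{-m}\sum_{0\le j<p^m,\,p\nmid j}\log j$, and $\psi_p(z)=-\gamma_p+\lim_{n\in\mathbb Z_{>0},\,n\to z}\sum_{1\le k<n,\,p\nmid k}\frac1k$ for $z\in\mathbb Z_p$. For $c\in 1+pW$ and $\sigma(t)=ct^p$ put $$G_{\underline a,\underline b}(t)=\sum_{i=1}^{s}\psi_p(a_i)-\sum_{i=1}^{s-1}\psi_p(b_i)+\gamma_p-p^{-1}\log c+\int_0^t\big(F_{\underline a,\underline b}(t)-F^{(1)}_{\underline a,\underline b}(ct^p)\big)\frac{dt}{t},$$ where $\int_0^t(-)\frac{dt}{t}$ sends $\sum_{n\ge1}x_nt^n$ to $\sum_{n\ge1}\frac{x_n}{n}t^n$, and $\mathscr F^{(\sigma)}_{\underline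 a,\underline b}(t)=G_{\underline a,\underline b}(t)/F_{\underline a,\underline b}(t)\in K[[t]]$. Let $[f]_{<n}$ denote the truncation of a power series $f$ to degrees $<n$. Then there is an integer $N_0$, depending only on $p,\underline a,\underline b$, such that for every $N\ge N_0$ the polynomial $h(t)=\prod_{i=0}^N[F^{(i)}_{\underline a,\underline b}(t)]_{<p}$ has coefficients in $W$ and is invertible in $W[[t]]$, and for every $c\in1+pW$ the series $\mathscr F^{(\sigma)}_{\underline a,\underline b}(t)$ lies in $W[[t]]$ and is the expansion of a unique element of $$W\langle t,h(t)^{-1}\rangle=\varprojlim_{n\ge1}\,W[t,h(t)^{-1}]/p^n .$$ Moreover, for every $\alpha\in W$ with $|h(\alpha)|_p=1$, evaluation at $t=\alpha$ sends this element to a well-defined value $\mathscr F^{(\sigma)}_{\underline a,\underline b}(\alpha)\in W$; one has $[F_{\underline a,\underline b}]_{<p^n}(\alpha)\ne0$ for all $n$, and $$\mathscr F^{(\sigma)}_{\underline a,\underline b}(\alpha)=\lim_{n\to\infty}\frac{[G_{\underline a,\underline b}]_{<p^n}(\alpha)}{[F_{\underline a,\underline b}]_{<p^n}(\alpha)} .$$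 -/

import Mathlib

open Filter Topology
open scoped Polynomial

namespace LogHypergeometric

noncomputable section

variable (p : ℕ) [Fact p.Prime]

/-- The Witt ring `W = W(𝔽̄_p)`. -/
abbrev W : Type := WittVector p (AlgebraicClosure (ZMod p))

/-- The fraction field `K` of `W`. -/
abbrev K : Type := FractionRing (W p)

/-- The canonical embedding `ℤ_p = W(𝔽_p) → W`. -/
def zpToW : ℤ_[p] →+* W p :=
  (WittVector.map (algebraMap (ZMod p) (AlgebraicClosure (ZMod p)))).comp
    (WittVector.equiv p).symm.toRingHom

theorem zpToW_injective : Function.Injective (zpToW p) := by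
  intro x y hxy
  exact (WittVector.equiv p).symm.injective (WittVector.map_injective _
    (algebraMap (ZMod p) (AlgebraicClosure (ZMod p))).injective hxy)

/-- The canonical embedding `ℚ_p → K`. -/
def qpToK : ℚ_[p] →+* K p :=
  IsFractionRing.lift (A := ℤ_[p]) (K := ℚ_[p])
    (g := (algebraMap (W p) (K p)).comp (zpToW p))
    ((IsFractionRing.injective (W p) (K p)).comp (zpToW_injective p))

/-- The `p`-adic absolute value on `K`, normalized by `|p|_p = p⁻¹`. -/
def padicAbs : AbsoluteValue (K p) ℝ :=
  (IsDiscreteValuationRing.maximalIdeal (W p)).adicAbv (b := (p : NNReal))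
    (by exact_mod_cast (Fact.out : p.Prime).one_lt)

/-- `x` is the limit of the sequence `u` for the `p`-adic absolute value of `K`. -/
def IsPadicLimit (u : ℕ → K p) (x : K p) : Prop :=
  Tendsto (fun m => padicAbs p (u m - x)) atTop (𝓝 0)

open Classical in
/-- The logarithm `log z = - ∑_{n ≥ 1} (1 - z)ⁿ / n` on the disc `|z - 1|_p < 1` of `K`
(where the series converges). -/
def logK (z : K p) : K p :=
  if h : ∃ x : K p, IsPadicLimit p
      (fun m => - ∑ n ∈ Finset.range m, (1 - z) ^ (n + 1) / ((n : K p) + 1)) x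
  then h.choose else 0

variable {p}

/-- The logarithm `log z = - ∑_{n ≥ 1} (1 - z)ⁿ / n` on the disc `|z - 1|_p < 1` of `ℚ_p`. -/
def logSeries (z : ℚ_[p]) : ℚ_[p] :=
  - ∑' n : ℕ, (1 - z) ^ (n + 1) / ((n : ℚ_[p]) + 1)

/-- The Iwasawa logarithm on `ℚ_pˣ`: write `z = p ^ k * u` with `u` a unit; then
`u ^ (p - 1)` lies in `1 + pℤ_p` and, since `log p = 0`,
`log z = log u = log (u ^ (p - 1)) / (p - 1)`. -/
def iwasawaLog (z : ℚ_[p]) : ℚ_[p] :=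
  logSeries ((z * (p : ℚ_[p]) ^ (-z.valuation)) ^ (p - 1)) / ((p : ℚ_[p]) - 1)

variable (p) in
/-- The `p`-adic Euler constant `γ_p`. -/
def eulerConst : ℚ_[p] :=
  limUnder atTop fun s : ℕ =>
    (∑ j ∈ (Finset.range (p ^ s)).filter (fun j => ¬ p ∣ j), iwasawaLog (j : ℚ_[p]))
      / (p : ℚ_[p]) ^ s

/-- `ψ̃_p(z) = lim ∑_{1 ≤ k < n, p ∤ k} 1 / k`, for positive integers `n` tending
`p`-adically to `z`. -/
def psiTilde (z : ℤ_[p]) : ℚ_[p] :=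
  limUnder (comap (fun n : ℕ => (n : ℤ_[p])) (𝓝 z) ⊓ 𝓟 {n : ℕ | 0 < n}) fun n : ℕ =>
    ∑ k ∈ (Finset.Ico 1 n).filter (fun k => ¬ p ∣ k), ((k : ℚ_[p]))⁻¹

/-- The `p`-adic digamma function `ψ_p`. -/
def psi (z : ℤ_[p]) : ℚ_[p] := - eulerConst p + psiTilde z

/-- The integer `l ∈ {0, …, p - 1}` with `α + l ≡ 0 mod p`. -/
def digitZero (α : ℤ_[p]) : ℕ := (-α).zmodRepr

theorem exists_dworkPrime (α : ℤ_[p]) : ∃ β : ℤ_[p], α + digitZero α = p * β := by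
  have h := (PadicInt.zmodRepr_spec (-α)).2
  rw [PadicInt.maximalIdeal_eq_span_p, Ideal.mem_span_singleton] at h
  obtain ⟨c, hc⟩ := h
  exact ⟨-c, by rw [mul_neg, ← hc, digitZero]; ring⟩

/-- The Dwork prime `α' = (α + l) / p`. -/
def dworkPrime (α : ℤ_[p]) : ℤ_[p] := (exists_dworkPrime α).choose

/-- The `i`-th Dwork prime `α^{(i)}`. -/
def dworkIter (i : ℕ) (α : ℤ_[p]) : ℤ_[p] := dworkPrime^[i] α

/-- The digits `[α]_n` of the expansion `α = - ∑ₙ [α]_n pⁿ`. -/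
def digit (n : ℕ) (α : ℤ_[p]) : ℕ := digitZero (dworkIter n α)

/-- The Pochhammer symbol `(α)_n = α (α + 1) ⋯ (α + n - 1)` in `ℚ_p`. -/
def poch (α : ℤ_[p]) (n : ℕ) : ℚ_[p] := ∏ k ∈ Finset.range n, ((α : ℚ_[p]) + k)

/-- The hypergeometric series `_{s}F_{s-1}(a; b; t)` with `s = r + 1`, over `ℚ_p`. -/
def hypSeries {r : ℕ} (a : Fin (r + 1) → ℤ_[p]) (b : Fin r → ℤ_[p]) : PowerSeries ℚ_[p] :=
  PowerSeries.mk fun n => (∏ i, poch (a i) n) / ((∏ j, poch (b j) n) * poch 1 n)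

/-- The series `F^{(i)}_{a,b}(t)` (with `F^{(0)} = F`), with coefficients viewed in `K`. -/
def hypF {r : ℕ} (a : Fin (r + 1) → ℤ_[p]) (b : Fin r → ℤ_[p]) (i : ℕ) : PowerSeries (K p) :=
  PowerSeries.map (qpToK p)
    (hypSeries (fun k => dworkIter i (a k)) (fun k => dworkIter i (b k)))

/-- The series `f(t^σ) = f(c t^p)`. -/
def substSigma (c : W p) (f : PowerSeries (K p)) : PowerSeries (K p) :=
  PowerSeries.mk fun n =>
    if p ∣ n then (algebraMap (W p) (K p) c) ^ (n / p) * PowerSeries.coeff (n / p) f else 0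

/-- The operator `∫₀ᵗ (-) dt/t`, sending `∑ aₙ tⁿ` (with `a₀ = 0`) to `∑ (aₙ / n) tⁿ`. -/
def integ (f : PowerSeries (K p)) : PowerSeries (K p) :=
  PowerSeries.mk fun n => PowerSeries.coeff n f / (n : K p)

/-- The series `G_{a,b}(t)` attached to the Frobenius `σ(t) = c t^p`. -/
def hypG {r : ℕ} (a : Fin (r + 1) → ℤ_[p]) (b : Fin r → ℤ_[p]) (c : W p) :
    PowerSeries (K p) :=
  PowerSeries.C
      (qpToK p (∑ i, psi (a i) - ∑ j, psi (b j) + eulerConst p)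
        - (p : K p)⁻¹ * logK p (algebraMap (W p) (K p) c))
    + integ (hypF a b 0 - substSigma c (hypF a b 1))

/-- The function `𝓕^{(σ)}_{a,b}(t) = G_{a,b}(t) / F_{a,b}(t)` in `K[[t]]`. -/
def hypLog {r : ℕ} (a : Fin (r + 1) → ℤ_[p]) (b : Fin r → ℤ_[p]) (c : W p) :
    PowerSeries (K p) :=
  hypG a b c * (hypF a b 0)⁻¹

/-- The polynomial `∏_{i=0}^N [F^{(i)}_{a,b}(t)]_{<p}`, a priori with coefficients in `K`. -/
def hypPoly {r : ℕ} (a : Fin (r + 1) → ℤ_[p]) (b : Fin r → ℤ_[p]) (N : ℕ) : (K p)[X] :=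
  ∏ i ∈ Finset.range (N + 1), PowerSeries.trunc p (hypF a b i)

/-- The conditions on the parameters `a`, `b`; here `q` is the number of `j` with `b_j ≠ 1`. -/
structure Admissible {r : ℕ} (a : Fin (r + 1) → ℤ_[p]) (b : Fin r → ℤ_[p]) : Prop where
  rational_a : ∀ i, ∃ x : ℚ, (x : ℚ_[p]) = a i
  rational_b : ∀ j, ∃ x : ℚ, (x : ℚ_[p]) = b j
  b_ne : ∀ j, ∀ m : ℕ, b j ≠ -(m : ℤ_[p])
  norm_b : ∀ j, b j ≠ 1 → ∀ i, ‖dworkIter i (b j)‖ = 1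
  /-- For each `n`, once the digits are rearranged in increasing order,
  `[a_{j+1}]_n < [b_j]_n` for `j = 1, …, q`. -/
  digits : ∀ n : ℕ, ∀ (ρ : Equiv.Perm (Fin (r + 1))) (τ : Equiv.Perm (Fin r)),
    Monotone (fun i => digit n (a (ρ i))) → Monotone (fun j => digit n (b (τ j))) →
    ∀ j : Fin r, (j : ℕ) < Nat.card {k : Fin r // b k ≠ 1} →
      digit n (a (ρ j.succ)) < digit n (b (τ j))

/-- The ring `W[t, h(t)⁻¹]`. -/
abbrev LocRing (h : (W p)[X]) : Type := Localization.Away h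

/-- The Tate algebra `W⟨t, h(t)⁻¹⟩ = lim_n W[t, h(t)⁻¹] / pⁿ`. -/
abbrev TateAlg (h : (W p)[X]) : Type :=
  AdicCompletion (Ideal.span {(p : LocRing h)}) (LocRing h)

theorem span_pow_le {p : ℕ} {A B : Type*} [CommRing A] [CommRing B] (φ : A →+* B) (n : ℕ) :
    Ideal.span {(p : A)} ^ n ≤ (Ideal.span {(p : B)} ^ n).comap φ := by
  rw [← Ideal.map_le_iff_le_comap, Ideal.map_pow, Ideal.map_span]
  simp

/-- For a ring homomorphism `φ : W[t, h⁻¹] → B`: the element `x` of `B` is the image of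
`f ∈ W⟨t, h⁻¹⟩` under the `p`-adic continuation of `φ`, that is,
`x mod pⁿ` is the image of `f mod pⁿ` under `W[t, h⁻¹] / pⁿ → B / pⁿ` for every `n`. -/
def IsImage {h : (W p)[X]} {B : Type*} [CommRing B] (φ : LocRing h →+* B)
    (f : TateAlg h) (x : B) : Prop :=
  ∀ n : ℕ,
    Ideal.quotientMap (Ideal.span {(p : B)} ^ n) φ (span_pow_le φ n)
      (AdicCompletion.evalₐ (Ideal.span {(p : LocRing h)}) n f)
      = Ideal.Quotient.mk (Ideal.span {(p : B)} ^ n) x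

/-- The expansion homomorphism `W[t, h⁻¹] → W[[t]]`, for `h` invertible in `W[[t]]`. -/
def toSeries (h : (W p)[X]) (hu : IsUnit (h : PowerSeries (W p))) :
    LocRing h →+* PowerSeries (W p) :=
  Localization.awayLift (Polynomial.coeToPowerSeries.ringHom (R := W p)) h hu

/-- The evaluation homomorphism `W[t, h⁻¹] → W` at `t = α`, for `h(α)` invertible in `W`. -/
def evalAt (h : (W p)[X]) (α : W p) (hu : IsUnit (h.eval α)) : LocRing h →+* W p :=
  Localization.awayLift (Polynomial.evalRingHom α) h hu

end

end LogHypergeometric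

open LogHypergeometric

/-!
Splitting off the last base-`p` digit of the index relates the coefficients of `F^{(i)}` to those
of `F^{(i+1)}`, up to a `p`-adically Lipschitz unit; the digit conditions are what keeps all the
factors integral. For such sequences Dwork's argument shows that `F(t) [q F]_{<p^n}` and
`[F]_{<p^n} (q F)(t)` agree modulo `p^{n-1}` whenever `p q(k)` is Lipschitz in the index `k`, where
`q F` has the coefficients of `F` multiplied by `q(k)`.

The series `G` is of this form. Its coefficients in degrees prime to `p` are those of `F` divided by
`k`. In degree `p l`, the coefficient of `F^{(1)}(c t^p)` is that of `F` times `1 + p l Φ(l)` with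
`Φ` Lipschitz, so that the weight is `-Φ(l)`; and `-Φ(0)` is the constant term of `G` because
`ψ_p(α)` and `p⁻¹ log c` are logarithmic derivatives at `0` of the factors of `1 + p l Φ(l)`.

Finally `[F]_{<p^m}` is congruent modulo `p` to the product of the `[F^{(k)}]_{<p} ^ (p^k)` for
`k < m`. Only finitely many polynomials occur among the `[F^{(k)}]_{<p}` modulo `p`, so
`[F]_{<p^m}` is invertible modulo every power of `p` once `h` is, and the quotients
`[G]_{<p^n} / [F]_{<p^n}` converge `p`-adically to `G / F` in the Tate algebra.
-/

namespace LogHypergeometric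

/-! ### Dwork congruences for systems of sequences -/

theorem dvd_mul_sub_mul {Q : Type*} [CommRing Q] {x a b c d : Q} (hac : x ∣ a - c)
    (hbd : x ∣ b - d) : x ∣ a * b - c * d := by
  rw [show a * b - c * d = (a - c) * b + c * (b - d) by ring]
  exact dvd_add (hac.mul_right _) (hbd.mul_left _)

theorem sum_range_mul_eq_sum_digits {M : Type*} [AddCommMonoid M] (m n : ℕ) (F : ℕ → M) :
    ∑ k ∈ Finset.range (m * n), F k
      = ∑ v ∈ Finset.range m, ∑ z ∈ Finset.range n, F (v + m * z) := by
  rw [Finset.sum_comm]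
  induction n with
  | zero => simp
  | succ n ih =>
    rw [mul_add_one, Finset.sum_range_add, ih, Finset.sum_range_succ]
    simp only [add_comm]

section Lipschitz

variable {Q : Type*} [CommRing Q] {p e : ℕ}

/-- `w` is `p`-adically Lipschitz with a gain of `e` digits:
`z ≡ z' mod p ^ k` implies `w z ≡ w z' mod p ^ (k + e)`. -/
def IsLip (p e : ℕ) (w : ℕ → Q) : Prop :=
  ∀ ⦃k z z'⦄, z ≡ z' [MOD p ^ k] → (p : Q) ^ (k + e) ∣ w z - w z'

/-- The two-variable version of `IsLip`. Asking for the condition in each variable separately is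
enough, by the ultrametric inequality. -/
def IsLip₂ (p e : ℕ) (w : ℕ → ℕ → Q) : Prop :=
  (∀ y, IsLip p e fun x => w x y) ∧ ∀ x, IsLip p e (w x)

theorem IsLip.const (p e : ℕ) (c : Q) : IsLip p e fun _ => c := fun _ _ _ _ => by simp

theorem IsLip.add {v w : ℕ → Q} (hv : IsLip p e v) (hw : IsLip p e w) :
    IsLip p e fun z => v z + w z := fun _ _ _ h => by
  rw [add_sub_add_comm]; exact dvd_add (hv h) (hw h)

theorem IsLip.neg {v : ℕ → Q} (hv : IsLip p e v) : IsLip p e fun z => -v z := fun _ _ _ h => by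
  rw [← neg_sub', dvd_neg]; exact hv h

theorem IsLip.mul {v w : ℕ → Q} (hv : IsLip p e v) (hw : IsLip p e w) :
    IsLip p e fun z => v z * w z :=
  fun _ _ _ h => dvd_mul_sub_mul (hv h) (hw h)

theorem IsLip.sum {ι : Type*} (s : Finset ι) {w : ι → ℕ → Q} (hw : ∀ i ∈ s, IsLip p e (w i)) :
    IsLip p e fun z => ∑ i ∈ s, w i z := fun _ _ _ h => by
  rw [← Finset.sum_sub_distrib]
  exact Finset.dvd_sum fun i hi => hw i hi h

theorem IsLip.prod {ι : Type*} (s : Finset ι) {w : ι → ℕ → Q} (hw : ∀ i ∈ s, IsLip p e (w i)) :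
    IsLip p e fun z => ∏ i ∈ s, w i z := by
  classical
  induction s using Finset.induction_on with
  | empty => simpa using IsLip.const p e (1 : Q)
  | insert i s hi ih =>
    simp only [Finset.prod_insert hi]
    exact (hw i (Finset.mem_insert_self i s)).mul
      (ih fun j hj => hw j (Finset.mem_insert_of_mem hj))

theorem IsLip.inv {u : ℕ → Qˣ} (hu : IsLip p e fun z => (u z : Q)) :
    IsLip p e fun z => ((u z)⁻¹ : Qˣ).val := fun _ z z' h => by
  have hsub : ((u z)⁻¹ : Qˣ).val - ((u z')⁻¹ : Qˣ).val
      = -((u z : Q) - u z') * (((u z)⁻¹ : Qˣ).val * ((u z')⁻¹ : Qˣ).val) := by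
    linear_combination ((u z')⁻¹ : Qˣ).val * (u z).mul_inv - ((u z)⁻¹ : Qˣ).val * (u z').mul_inv
  rw [hsub]
  exact (dvd_neg.2 (hu h)).mul_right _

theorem IsLip.mono {e' : ℕ} (he : e' ≤ e) {w : ℕ → Q} (hw : IsLip p e w) : IsLip p e' w :=
  fun _ _ _ h => (pow_dvd_pow _ (by lia)).trans (hw h)

theorem IsLip.pow_mul {w : ℕ → Q} (n : ℕ) (hw : IsLip p e w) :
    IsLip p (e + n) fun z => (p : Q) ^ n * w z := fun k _ _ h => by
  rw [← mul_sub, ← add_assoc, pow_add, mul_comm]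
  exact mul_dvd_mul_left _ (hw h)

theorem IsLip.map {Q' : Type*} [CommRing Q'] (φ : Q →+* Q') {w : ℕ → Q} (hw : IsLip p e w) :
    IsLip p e fun z => φ (w z) := fun _ _ _ h => by
  simpa only [map_pow, map_natCast, map_sub] using map_dvd φ (hw h)

theorem IsLip.comp_digit {w : ℕ → Q} (hw : IsLip p e w) (v : ℕ) :
    IsLip p (e + 1) fun z => w (v + p * z) := fun k _ _ h => by
  rw [add_comm e, ← add_assoc]
  exact hw (Nat.ModEq.add_left _ (pow_succ' p k ▸ Nat.ModEq.mul_left' _ h))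

theorem IsLip.of_natCast_mul [IsDomain Q] (hp : (p : Q) ≠ 0) {w : ℕ → Q}
    (hw : IsLip p (e + 1) fun z => p * w z) : IsLip p e w := fun k z z' h => by
  have h' := hw h
  rwa [← mul_sub, ← add_assoc, pow_succ', mul_dvd_mul_iff_left hp] at h'

theorem IsLip.dvd_sub_zero {w : ℕ → Q} (hw : IsLip p 1 w) (z : ℕ) : (p : Q) ∣ w z - w 0 := by
  simpa using hw (k := 0) (z := z) (z' := 0) (by simp [Nat.modEq_one])

theorem isLip_natCast : IsLip p 0 fun z : ℕ => (z : Q) := fun k z z' h => by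
  have h' : ((p ^ k : ℕ) : ℤ) ∣ (z : ℤ) - z' := Nat.modEq_iff_dvd.1 h.symm
  simpa using map_dvd (Int.castRingHom Q) h'

theorem IsLip₂.mul {v w : ℕ → ℕ → Q} (hv : IsLip₂ p e v) (hw : IsLip₂ p e w) :
    IsLip₂ p e fun x y => v x y * w x y :=
  ⟨fun y => (hv.1 y).mul (hw.1 y), fun x => (hv.2 x).mul (hw.2 x)⟩

theorem IsLip.left {w : ℕ → Q} (hw : IsLip p e w) : IsLip₂ p e fun x _ => w x :=
  ⟨fun _ => hw, fun _ => IsLip.const p e _⟩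

theorem IsLip.right {w : ℕ → Q} (hw : IsLip p e w) : IsLip₂ p e fun _ y => w y :=
  ⟨fun _ => IsLip.const p e _, fun _ => hw⟩

theorem IsLip₂.mono {e' : ℕ} (he : e' ≤ e) {w : ℕ → ℕ → Q} (hw : IsLip₂ p e w) :
    IsLip₂ p e' w :=
  ⟨fun y => (hw.1 y).mono he, fun x => (hw.2 x).mono he⟩

theorem IsLip₂.comp_digit {w : ℕ → ℕ → Q} (hw : IsLip₂ p e w) (u v : ℕ) :
    IsLip₂ p (e + 1) fun x y => w (u + p * x) (v + p * y) :=
  ⟨fun _ => (hw.1 _).comp_digit u, fun _ => (hw.2 _).comp_digit v⟩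

theorem IsLip₂.exists_eq_add_natCast_mul [IsDomain Q] (hp : (p : Q) ≠ 0) {w : ℕ → ℕ → Q}
    (hw : IsLip₂ p 1 w) :
    ∃ w' : ℕ → ℕ → Q, IsLip₂ p 0 w' ∧ ∀ x y, w x y = w 0 0 + p * w' x y := by
  have hdvd : ∀ x y, (p : Q) ∣ w x y - w 0 0 := fun x y => by
    rw [← sub_add_sub_cancel _ (w 0 y)]
    exact dvd_add ((hw.1 y).dvd_sub_zero x) ((hw.2 0).dvd_sub_zero y)
  choose w' hw' using hdvd
  refine ⟨w', ⟨fun y => IsLip.of_natCast_mul hp ?_, fun x => IsLip.of_natCast_mul hp ?_⟩,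
    fun x y => by rw [← hw', add_sub_cancel]⟩
  · simpa only [← sub_eq_add_neg, hw'] using (hw.1 y).add (IsLip.const p 1 (-w 0 0))
  · simpa only [← sub_eq_add_neg, hw'] using (hw.2 x).add (IsLip.const p 1 (-w 0 0))

end Lipschitz

section DworkSystem

variable {Q : Type*} [CommRing Q] {p : ℕ} {St : Type*} {o : St} {A : ℕ → St → ℕ → Q}

/-- A family of sequences `A i S`, indexed by a level `i` and a state `S`, with relations
`A i S (v + p z) = V z * A (i + 1) S' z` that strip off the last `p`-adic digit `v`.
The transition may leave the distinguished state `o` only at the cost of a factor `p`; this is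
what Dwork's congruences for the sequences `A i o` rest on. -/
def IsDworkSystem (p : ℕ) (o : St) (A : ℕ → St → ℕ → Q) : Prop :=
  ∀ i S v, v < p → ∃ (S' : St) (V : ℕ → Q), (∀ z, A i S (v + p * z) = V z * A (i + 1) S' z) ∧
    IsLip p 1 V ∧ (S' = o ∨ ∃ V' : ℕ → Q, IsLip p 0 V' ∧ ∀ z, V z = p * V' z)

theorem IsDworkSystem.map {Q' : Type*} [CommRing Q'] (φ : Q →+* Q') (hA : IsDworkSystem p o A) :
    IsDworkSystem p o fun i S z => φ (A i S z) := by
  intro i S v hv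
  obtain ⟨S', V, hV, hLip, hS'⟩ := hA i S v hv
  refine ⟨S', fun z => φ (V z), fun z => by simp only [hV, map_mul], hLip.map φ, hS'.imp_right ?_⟩
  rintro ⟨V', hLip', hV'⟩
  exact ⟨fun z => φ (V' z), hLip'.map φ, fun z => by simp only [hV', map_mul, map_natCast]⟩

/-- The weighted antisymmetric sums through which Dwork measures how far
`X(t) Y_{<M}(t) - X_{<M}(t) Y(t)` is from vanishing; `x` and `y` number blocks of length `M`. -/
def crossSum (X Y : ℕ → Q) (M x y : ℕ) (w : ℕ → ℕ → Q) (t : Q) : Q :=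
  ∑ e ∈ Finset.range M, ∑ f ∈ Finset.range M,
    w e f * (X (f + M * x) * Y (e + M * y) - X (f + M * y) * Y (e + M * x)) * t ^ (e + f)

theorem crossSum_self_const (X : ℕ → Q) (M x y : ℕ) (c t : Q) :
    crossSum X X M x y (fun _ _ => c) t = 0 := by
  have hanti : ∀ g : ℕ → ℕ → Q,
      ∑ e ∈ Finset.range M, ∑ f ∈ Finset.range M, (g e f - g f e) = 0 := fun g => by
    simp only [Finset.sum_sub_distrib]
    rw [Finset.sum_comm, sub_self]
  rw [← hanti fun e f => c * (X (f + M * x) * X (e + M * y)) * t ^ (e + f), crossSum]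
  refine Finset.sum_congr rfl fun e _ => Finset.sum_congr rfl fun f _ => ?_
  rw [add_comm f e]; ring

theorem crossSum_const_add_mul (X Y : ℕ → Q) (M x y : ℕ) (c d t : Q) (w : ℕ → ℕ → Q) :
    crossSum X Y M x y (fun e f => c + d * w e f) t
      = crossSum X Y M x y (fun _ _ => c) t + d * crossSum X Y M x y w t := by
  simp only [crossSum, Finset.mul_sum, ← Finset.sum_add_distrib]
  refine Finset.sum_congr rfl fun e _ => Finset.sum_congr rfl fun f _ => ?_
  ring

theorem pow_dvd_crossSum_of_digits {X Y : ℕ → Q} {m x y : ℕ} {w : ℕ → ℕ → Q} {t : Q}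
    {X' Y' VX VY : ℕ → ℕ → Q}
    (hX : ∀ v < p, ∀ z, X (v + p * z) = VX v z * X' v z) (hVX : ∀ v < p, IsLip p 1 (VX v))
    (hY : ∀ v < p, ∀ z, Y (v + p * z) = VY v z * Y' v z) (hVY : ∀ v < p, IsLip p 1 (VY v))
    (h : ∀ u < p, ∀ v < p, (p : Q) ^ (m + 1) ∣ crossSum (X' v) (Y' u) (p ^ m) x y
      (fun e f => w (u + p * e) (v + p * f) * (VY u e * VX v f)) (t ^ p)) :
    (p : Q) ^ (m + 1) ∣ crossSum X Y (p ^ (m + 1)) x y w t := by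
  rw [crossSum, pow_succ' p m, sum_range_mul_eq_sum_digits]
  simp_rw [sum_range_mul_eq_sum_digits p (p ^ m)]
  refine Finset.dvd_sum fun u hu => ?_
  rw [Finset.sum_comm]
  refine Finset.dvd_sum fun v hv => ?_
  rw [Finset.mem_range] at hu hv
  refine (dvd_iff_dvd_of_dvd_sub ?_).2 ((h u hu v hv).mul_left (t ^ (u + v)))
  simp only [crossSum, Finset.mul_sum]
  rw [← Finset.sum_sub_distrib]
  refine Finset.dvd_sum fun e _ => ?_
  rw [← Finset.sum_sub_distrib]
  refine Finset.dvd_sum fun f _ => ?_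
  have hshift : ∀ {V : ℕ → Q}, IsLip p 1 V → ∀ z x, (p : Q) ^ (m + 1) ∣ V (z + p ^ m * x) - V z :=
    fun hV z x => hV (by simp [Nat.ModEq])
  have hxy := dvd_mul_sub_mul (hshift (hVX v hv) f x) (hshift (hVY u hu) e y)
  have hyx := dvd_mul_sub_mul (hshift (hVX v hv) f y) (hshift (hVY u hu) e x)
  have hidx : ∀ v z x, v + p * z + p * p ^ m * x = v + p * (z + p ^ m * x) := by intros; ring
  have ht : t ^ (u + p * e + (v + p * f)) = t ^ (u + v) * (t ^ p) ^ (e + f) := by ring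
  simp only [hidx, ht, hX v hv, hY u hu]
  set s := t ^ (u + v) * (t ^ p) ^ (e + f)
  convert dvd_sub
    (hxy.mul_right (w (u + p * e) (v + p * f) * s * X' v (f + p ^ m * x) * Y' u (e + p ^ m * y)))
    (hyx.mul_right (w (u + p * e) (v + p * f) * s * X' v (f + p ^ m * y) * Y' u (e + p ^ m * x)))
    using 1
  ring

theorem exists_eq_add_natCast_mul_of_transition [IsDomain Q] (hp : (p : Q) ≠ 0) {S T : St}
    {w : ℕ → ℕ → Q} {V U : ℕ → Q} (hw : IsLip₂ p 1 w) (hV : IsLip p 1 V) (hU : IsLip p 1 U)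
    (hS : S = o ∨ ∃ V' : ℕ → Q, IsLip p 0 V' ∧ ∀ z, V z = p * V' z)
    (hT : T = o ∨ ∃ U' : ℕ → Q, IsLip p 0 U' ∧ ∀ z, U z = p * U' z) :
    ∃ (c : Q) (w' : ℕ → ℕ → Q), IsLip₂ p 0 w' ∧
      (∀ e f, w e f * (U e * V f) = c + p * w' e f) ∧ (S = T ∨ c = 0) := by
  have hw₀ := hw.mono zero_le_one
  rcases hT with hT | ⟨U', hU', hUU'⟩
  · rcases hS with hS | ⟨V', hV', hVV'⟩
    · obtain ⟨w', hw', heq⟩ :=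
        (hw.mul (hU.left.mul hV.right)).exists_eq_add_natCast_mul hp
      exact ⟨_, w', hw', heq, Or.inl (hS.trans hT.symm)⟩
    · exact ⟨0, fun e f => w e f * (U e * V' f),
        hw₀.mul ((hU.mono zero_le_one).left.mul hV'.right), fun e f => by rw [hVV']; ring,
        Or.inr rfl⟩
  · exact ⟨0, fun e f => w e f * (U' e * V f),
      hw₀.mul (hU'.left.mul (hV.mono zero_le_one).right), fun e f => by rw [hUU']; ring,
      Or.inr rfl⟩

theorem IsDworkSystem.pow_dvd_crossSum [IsDomain Q] (hp : (p : Q) ≠ 0) (hA : IsDworkSystem p o A)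
    (m i : ℕ) (S T : St) (x y : ℕ) {w : ℕ → ℕ → Q} (hw : IsLip₂ p 0 w) (t : Q) :
    (p : Q) ^ m ∣ crossSum (A i S) (A i T) (p ^ m) x y w t := by
  induction m generalizing i S T w t with
  | zero => simp
  | succ m ih =>
    choose! next V hAV hV hnext using hA i
    refine pow_dvd_crossSum_of_digits (hAV S) (hV S) (hAV T) (hV T) fun u hu v hv => ?_
    obtain ⟨c, w', hw', heq, hc⟩ := exists_eq_add_natCast_mul_of_transition hp
      (hw.comp_digit u v) (hV S v hv) (hV T u hu) (hnext S v hv) (hnext T u hu)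
    have hconst : crossSum (A (i + 1) (next S v)) (A (i + 1) (next T u)) (p ^ m) x y
        (fun _ _ => c) (t ^ p) = 0 := by
      rcases hc with hST | rfl
      · rw [hST, crossSum_self_const]
      · simp [crossSum]
    simp only [heq]
    rw [crossSum_const_add_mul, hconst, zero_add, pow_succ']
    exact mul_dvd_mul_left _ (ih (i + 1) _ _ hw' (t ^ p))

theorem IsDworkSystem.pow_dvd_sum_weight_sub [IsDomain Q] (hp : (p : Q) ≠ 0)
    (hA : IsDworkSystem p o A) {c : ℕ → Q} (hc : IsLip p 0 c) (i m y : ℕ) (t : Q) :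
    (p : Q) ^ m ∣ ∑ e ∈ Finset.range (p ^ m), ∑ f ∈ Finset.range (p ^ m),
      (c (f + p ^ m * y) - c e) * (A i o (f + p ^ m * y) * A i o e) * t ^ (e + f) := by
  have hcross := hA.pow_dvd_crossSum hp m i o o 0 y hc.left t
  have hshift : (p : Q) ^ m ∣ ∑ e ∈ Finset.range (p ^ m), ∑ f ∈ Finset.range (p ^ m),
      (c (f + p ^ m * y) - c f) * (A i o (f + p ^ m * y) * A i o e) * t ^ (e + f) :=
    Finset.dvd_sum fun e _ => Finset.dvd_sum fun f _ =>
      ((hc (by simp [Nat.ModEq])).mul_right _).mul_right _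
  have hswap : ∑ e ∈ Finset.range (p ^ m), ∑ f ∈ Finset.range (p ^ m),
        c f * (A i o (f + p ^ m * y) * A i o e) * t ^ (e + f)
      = ∑ e ∈ Finset.range (p ^ m), ∑ f ∈ Finset.range (p ^ m),
        c e * (A i o (e + p ^ m * y) * A i o f) * t ^ (e + f) := by
    rw [Finset.sum_comm]
    simp only [add_comm]
  have hsplit : ∑ e ∈ Finset.range (p ^ m), ∑ f ∈ Finset.range (p ^ m),
        (c (f + p ^ m * y) - c e) * (A i o (f + p ^ m * y) * A i o e) * t ^ (e + f)
      = ∑ e ∈ Finset.range (p ^ m), ∑ f ∈ Finset.range (p ^ m),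
          (c (f + p ^ m * y) - c f) * (A i o (f + p ^ m * y) * A i o e) * t ^ (e + f)
        + (∑ e ∈ Finset.range (p ^ m), ∑ f ∈ Finset.range (p ^ m),
            c f * (A i o (f + p ^ m * y) * A i o e) * t ^ (e + f)
          - ∑ e ∈ Finset.range (p ^ m), ∑ f ∈ Finset.range (p ^ m),
            c e * (A i o (f + p ^ m * y) * A i o e) * t ^ (e + f)) := by
    simp only [← Finset.sum_sub_distrib, ← Finset.sum_add_distrib]
    exact Finset.sum_congr rfl fun e _ => Finset.sum_congr rfl fun f _ => by ring
  rw [hsplit, hswap]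
  refine dvd_add hshift ?_
  convert hcross using 1
  simp only [crossSum, mul_zero, add_zero, ← Finset.sum_sub_distrib]
  exact Finset.sum_congr rfl fun e _ => Finset.sum_congr rfl fun f _ => by ring

end DworkSystem

section Truncation

open PowerSeries (trunc coeff mk)

variable {R : Type*} [CommRing R] {p : ℕ} {St : Type*} {o : St} {A : ℕ → St → ℕ → R}

theorem trunc_mk_eq_sum (n : ℕ) (B : ℕ → R) :
    trunc n (mk B) = ∑ k ∈ Finset.range n, Polynomial.C (B k) * Polynomial.X ^ k := by
  ext k
  simp [PowerSeries.coeff_trunc, Polynomial.finsetSum_coeff, Polynomial.coeff_X_pow]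

theorem trunc_mul_mk_eq_sum (m n : ℕ) (B : ℕ → R) :
    trunc (m * n) (mk B) = ∑ y ∈ Finset.range n, Polynomial.X ^ (m * y) *
      ∑ f ∈ Finset.range m, Polynomial.C (B (f + m * y)) * Polynomial.X ^ f := by
  rw [trunc_mk_eq_sum, sum_range_mul_eq_sum_digits, Finset.sum_comm]
  simp only [Finset.mul_sum, pow_add]
  exact Finset.sum_congr rfl fun y _ => Finset.sum_congr rfl fun f _ => by ring

theorem coeff_coe_trunc_mul_trunc {n N : ℕ} (hn : n < N) (M : ℕ) (f g : PowerSeries R) :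
    (trunc N f * trunc M g).coeff n = coeff n (f * (trunc M g : PowerSeries R)) := by
  rw [← Polynomial.coeff_coe, Polynomial.coe_mul, ← PowerSeries.coeff_coe_trunc_of_lt hn,
    PowerSeries.trunc_trunc_mul, PowerSeries.coeff_coe_trunc_of_lt hn]

theorem natCast_polynomial_ne_zero (hp : (p : R) ≠ 0) : (p : R[X]) ≠ 0 := by
  rwa [← map_natCast Polynomial.C, Ne, Polynomial.C_eq_zero]

theorem natCast_pow_dvd_polynomial_iff {n : ℕ} {f : R[X]} :
    (p : R[X]) ^ n ∣ f ↔ ∀ k, (p : R) ^ n ∣ f.coeff k := by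
  rw [← map_natCast Polynomial.C, ← map_pow, Polynomial.C_dvd_iff_dvd_coeff]

theorem IsDworkSystem.pow_dvd_trunc_mul_trunc_sub [IsDomain R] (hp : (p : R) ≠ 0)
    (hA : IsDworkSystem p o A) {c : ℕ → R} (hc : IsLip p 0 c) (i m n : ℕ) :
    (p : R[X]) ^ m ∣ trunc (p ^ m * n) (mk fun k => c k * A i o k) * trunc (p ^ m) (mk (A i o))
      - trunc (p ^ m * n) (mk (A i o)) * trunc (p ^ m) (mk fun k => c k * A i o k) := by
  rw [trunc_mul_mk_eq_sum, trunc_mul_mk_eq_sum, trunc_mk_eq_sum, trunc_mk_eq_sum, Finset.sum_mul,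
    Finset.sum_mul, ← Finset.sum_sub_distrib]
  refine Finset.dvd_sum fun y _ => ?_
  rw [mul_assoc, mul_assoc, ← mul_sub, Finset.sum_mul_sum, Finset.sum_mul_sum,
    ← Finset.sum_sub_distrib]
  refine Dvd.dvd.mul_left ?_ _
  convert (hA.map Polynomial.C).pow_dvd_sum_weight_sub (natCast_polynomial_ne_zero hp)
    (hc.map Polynomial.C) i m y Polynomial.X using 1
  rw [Finset.sum_comm]
  refine Finset.sum_congr rfl fun f _ => ?_
  rw [← Finset.sum_sub_distrib]
  refine Finset.sum_congr rfl fun e _ => ?_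
  simp only [map_mul]
  ring

/-- Dwork's congruence for a weight `c = p q` only known to be Lipschitz after multiplication
by `p`. -/
theorem IsDworkSystem.pow_dvd_coeff_mul_trunc_sub [IsDomain R] (hp : (p : R) ≠ 0)
    (hA : IsDworkSystem p o A) {q : ℕ → R} (hq : IsLip p 0 fun k => p * q k) (i m n : ℕ) :
    (p : R) ^ m ∣ coeff n
      ((mk fun k => q k * A i o k) * (trunc (p ^ (m + 1)) (mk (A i o)) : PowerSeries R)
        - mk (A i o) * (trunc (p ^ (m + 1)) (mk fun k => q k * A i o k) : PowerSeries R)) := by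
  have hp_pos : 0 < p := Nat.pos_of_ne_zero (by rintro rfl; simp at hp)
  have hn : n < p ^ (m + 1) * (n + 1) :=
    n.lt_succ_self.trans_le (Nat.le_mul_of_pos_left _ (by positivity))
  have hsmul : (mk fun k => p * q k * A i o k) = (p : R) • mk fun k => q k * A i o k := by
    ext k; simp only [PowerSeries.coeff_mk, PowerSeries.coeff_smul, smul_eq_mul, mul_assoc]
  have h := natCast_pow_dvd_polynomial_iff.1
    (hA.pow_dvd_trunc_mul_trunc_sub hp hq i (m + 1) (n + 1)) n
  rw [hsmul, map_smul, map_smul, smul_mul_assoc, mul_smul_comm, ← smul_sub,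
    Polynomial.coeff_smul, smul_eq_mul, pow_succ', mul_dvd_mul_iff_left hp, Polynomial.coeff_sub,
    coeff_coe_trunc_mul_trunc hn, coeff_coe_trunc_mul_trunc hn, ← map_sub] at h
  exact h

end Truncation

section ResidueModP

open PowerSeries (trunc mk)

variable {R : Type*} [CommRing R] {p : ℕ} [Fact p.Prime] {St : Type*} {o : St}
  {A : ℕ → St → ℕ → R}

theorem IsDworkSystem.map_apply_add_mul (hA : IsDworkSystem p o A) (h1 : ∀ i, A i o 0 = 1)
    (φ : R →+* ZMod p) (i : ℕ) {v : ℕ} (hv : v < p) (z : ℕ) :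
    φ (A i o (v + p * z)) = φ (A i o v) * φ (A (i + 1) o z) := by
  obtain ⟨S', V, hV, hLip, hS'⟩ := hA i o v hv
  have hv0 : A i o v = V 0 * A (i + 1) S' 0 := by simpa using hV 0
  rcases hS' with rfl | ⟨V', -, hV'⟩
  · have hVz : φ (V z) = φ (V 0) := by
      simpa [sub_eq_zero] using map_dvd φ (hLip.dvd_sub_zero z)
    rw [hV, hv0, h1, mul_one, map_mul, hVz]
  · simp [hV, hv0, hV']

theorem IsDworkSystem.map_trunc_pow_succ (hA : IsDworkSystem p o A) (h1 : ∀ i, A i o 0 = 1)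
    (φ : R →+* ZMod p) (i m : ℕ) :
    (trunc (p ^ (m + 1)) (mk (A i o))).map φ
      = (trunc p (mk (A i o))).map φ * (trunc (p ^ m) (mk (A (i + 1) o))).map φ ^ p := by
  rw [← ZMod.expand_card]
  simp only [trunc_mk_eq_sum, pow_succ', sum_range_mul_eq_sum_digits, Polynomial.map_sum,
    Polynomial.map_mul, Polynomial.map_C, Polynomial.map_pow, Polynomial.map_X, map_sum, map_mul,
    map_pow, Polynomial.expand_C, Polynomial.expand_X, Finset.sum_mul_sum]
  refine Finset.sum_congr rfl fun v hv => Finset.sum_congr rfl fun z _ => ?_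
  rw [hA.map_apply_add_mul h1 φ i (Finset.mem_range.1 hv), map_mul]
  ring

theorem IsDworkSystem.map_trunc_pow (hA : IsDworkSystem p o A) (h1 : ∀ i, A i o 0 = 1)
    (φ : R →+* ZMod p) (i m : ℕ) :
    (trunc (p ^ m) (mk (A i o))).map φ
      = ∏ k ∈ Finset.range m, (trunc p (mk (A (i + k) o))).map φ ^ p ^ k := by
  induction m generalizing i with
  | zero => simp [trunc_mk_eq_sum, h1]
  | succ m ih =>
    rw [hA.map_trunc_pow_succ h1, ih, Finset.prod_range_succ', ← Finset.prod_pow, mul_comm]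
    simp only [pow_succ, pow_mul, pow_zero, pow_one, add_zero, add_assoc, add_comm 1]

end ResidueModP

/-! ### Dwork primes and unit parts of Pochhammer symbols -/

noncomputable section

variable {p : ℕ} [Fact p.Prime]

theorem not_isUnit_iff_dvd (x : ℤ_[p]) : ¬ IsUnit x ↔ (p : ℤ_[p]) ∣ x := by
  rw [← mem_nonunits_iff, PadicInt.mem_nonunits, PadicInt.norm_lt_one_iff_dvd]

theorem isUnit_natCast_iff (n : ℕ) : IsUnit (n : ℤ_[p]) ↔ ¬ p ∣ n := by
  rw [← not_iff_not, not_not, not_isUnit_iff_dvd, ← PadicInt.norm_lt_one_iff_dvd,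
    PadicInt.norm_natCast_lt_one_iff]

theorem coe_prod {ι : Type*} (s : Finset ι) (f : ι → ℤ_[p]) :
    ((∏ i ∈ s, f i : ℤ_[p]) : ℚ_[p]) = ∏ i ∈ s, (f i : ℚ_[p]) :=
  map_prod PadicInt.Coe.ringHom f s

theorem coe_units_inv (u : ℤ_[p]ˣ) : ((u⁻¹ : ℤ_[p]ˣ).val : ℚ_[p]) = (u.val : ℚ_[p])⁻¹ :=
  eq_inv_of_mul_eq_one_left (by rw [← PadicInt.coe_mul, Units.inv_mul, PadicInt.coe_one])

theorem digitZero_lt (α : ℤ_[p]) : digitZero α < p := PadicInt.zmodRepr_lt_p _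

theorem add_digitZero (α : ℤ_[p]) : α + digitZero α = p * dworkPrime α :=
  (exists_dworkPrime α).choose_spec

theorem isUnit_add_natCast_iff (α : ℤ_[p]) (k : ℕ) :
    IsUnit (α + k) ↔ ¬ k ≡ digitZero α [MOD p] := by
  rw [← not_iff_not, not_not, not_isUnit_iff_dvd, Nat.modEq_iff_dvd,
    ← PadicInt.norm_int_lt_one_iff_dvd, PadicInt.norm_lt_one_iff_dvd]
  have h : α + k = p * dworkPrime α - ((digitZero α : ℤ_[p]) - k) := by
    rw [← add_digitZero]; ring
  rw [h, dvd_sub_right (dvd_mul_right _ _)]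
  push_cast
  rfl

theorem digitZero_eq_of_dvd {α : ℤ_[p]} {v : ℕ} (hv : v < p) (h : (p : ℤ_[p]) ∣ α + v) :
    digitZero α = v := by
  rw [← not_isUnit_iff_dvd, isUnit_add_natCast_iff, not_not] at h
  exact (h.eq_of_lt_of_lt hv (digitZero_lt α)).symm

theorem dworkPrime_eq_of_add_eq {α β : ℤ_[p]} (h : α + digitZero α = p * β) :
    dworkPrime α = β :=
  mul_left_cancel₀ (Nat.cast_ne_zero.2 (Fact.out : p.Prime).ne_zero)
    ((add_digitZero α).symm.trans h)

theorem digitZero_add_natCast_mul (α : ℤ_[p]) (z : ℕ) :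
    digitZero (α + ((p * z : ℕ) : ℤ_[p])) = digitZero α :=
  digitZero_eq_of_dvd (digitZero_lt α)
    ⟨dworkPrime α + z, by push_cast; linear_combination add_digitZero α⟩

theorem dworkPrime_add_natCast_mul (α : ℤ_[p]) (z : ℕ) :
    dworkPrime (α + ((p * z : ℕ) : ℤ_[p])) = dworkPrime α + z :=
  dworkPrime_eq_of_add_eq <| by
    rw [digitZero_add_natCast_mul]; push_cast; linear_combination add_digitZero α

theorem digitZero_one : digitZero (1 : ℤ_[p]) = p - 1 :=
  digitZero_eq_of_dvd (Nat.sub_lt (Fact.out : p.Prime).pos one_pos)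
    ⟨1, by rw [Nat.cast_sub (Fact.out : p.Prime).one_le]; ring⟩

theorem dworkPrime_one : dworkPrime (1 : ℤ_[p]) = 1 :=
  dworkPrime_eq_of_add_eq <| by
    rw [digitZero_one, Nat.cast_sub (Fact.out : p.Prime).one_le]; ring

theorem dworkIter_succ (i : ℕ) (α : ℤ_[p]) : dworkIter (i + 1) α = dworkPrime (dworkIter i α) :=
  Function.iterate_succ_apply' _ _ _

theorem dworkIter_one (i : ℕ) : dworkIter i (1 : ℤ_[p]) = 1 :=
  Function.iterate_fixed dworkPrime_one i

open Classical in
/-- The factor of `x` prime to `p`, up to replacing it by `1` when `x` is not a unit; it enters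
the comparison of `(α)_{v + p z}` with `(α')_z`. -/
def unitPart (x : ℤ_[p]) : ℤ_[p]ˣ := if h : IsUnit x then h.unit else 1

theorem unitPart_of_isUnit {x : ℤ_[p]} (h : IsUnit x) : (unitPart x : ℤ_[p]) = x := by
  simp [unitPart, h]

theorem unitPart_of_not_isUnit {x : ℤ_[p]} (h : ¬ IsUnit x) : unitPart x = 1 := by
  simp [unitPart, h]

theorem pow_succ_dvd_unitPart_sub {x y : ℤ_[p]} {n : ℕ} (h : (p : ℤ_[p]) ^ (n + 1) ∣ x - y) :
    (p : ℤ_[p]) ^ (n + 1) ∣ (unitPart x : ℤ_[p]) - unitPart y := by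
  have hxy : IsUnit x ↔ IsUnit y := by
    rw [← not_iff_not, not_isUnit_iff_dvd, not_isUnit_iff_dvd]
    exact dvd_iff_dvd_of_dvd_sub ((dvd_pow_self _ n.succ_ne_zero).trans h)
  by_cases hx : IsUnit x
  · rwa [unitPart_of_isUnit hx, unitPart_of_isUnit (hxy.1 hx)]
  · rw [unitPart_of_not_isUnit hx, unitPart_of_not_isUnit (mt hxy.2 hx), sub_self]
    exact dvd_zero _

theorem add_natCast_eq_unitPart_mul (α : ℤ_[p]) {k : ℕ} (hk : k < p) :
    α + k = unitPart (α + (k : ℤ_[p])) * if k = digitZero α then p * dworkPrime α else 1 := by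
  have hmod : k ≡ digitZero α [MOD p] ↔ k = digitZero α :=
    ⟨fun h => h.eq_of_lt_of_lt hk (digitZero_lt α), fun h => h ▸ rfl⟩
  split_ifs with h
  · rw [unitPart_of_not_isUnit (by rwa [isUnit_add_natCast_iff, not_not, hmod]), h, add_digitZero]
    simp
  · rw [unitPart_of_isUnit (by rwa [isUnit_add_natCast_iff, hmod]), mul_one]

/-- The product of the unit parts of `α, α + 1, …, α + n - 1`. -/
def unitPoch (α : ℤ_[p]) (n : ℕ) : ℤ_[p]ˣ := ∏ k ∈ Finset.range n, unitPart (α + k)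

theorem unitPoch_add (α : ℤ_[p]) (m n : ℕ) :
    unitPoch α (m + n) = unitPoch α m * unitPoch (α + (m : ℤ_[p])) n := by
  simp only [unitPoch, Finset.prod_range_add, Nat.cast_add, add_assoc]

theorem unitPoch_add_one_mul (α : ℤ_[p]) (n : ℕ) :
    unitPoch (α + 1) n * unitPart α = unitPoch α n * unitPart (α + (n : ℤ_[p])) := by
  have h := unitPoch_add α 1 n
  rw [add_comm 1 n, unitPoch_add] at h
  simpa [unitPoch, mul_comm] using h.symm

theorem pow_succ_dvd_unitPoch_sub {x y : ℤ_[p]} {n : ℕ} (h : (p : ℤ_[p]) ^ (n + 1) ∣ x - y)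
    (m : ℕ) : (p : ℤ_[p]) ^ (n + 1) ∣ (unitPoch x m : ℤ_[p]) - unitPoch y m := by
  induction m with
  | zero => simp [unitPoch]
  | succ m ih =>
    simp only [unitPoch, Finset.prod_range_succ, Units.val_mul] at ih ⊢
    exact dvd_mul_sub_mul ih (pow_succ_dvd_unitPart_sub (by simpa using h))

theorem isLip_unitPoch_add_natCast_mul (α : ℤ_[p]) (m : ℕ) :
    IsLip p 1 fun z => (unitPoch (α + ((p * z : ℕ) : ℤ_[p])) m : ℤ_[p]) := fun k z z' h =>
  pow_succ_dvd_unitPoch_sub (by simpa using isLip_natCast.comp_digit (Q := ℤ_[p]) 0 h) m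

theorem poch_add (α : ℤ_[p]) (m n : ℕ) : poch α (m + n) = poch α m * poch (α + (m : ℤ_[p])) n := by
  simp only [poch, Finset.prod_range_add, Nat.cast_add, add_assoc, PadicInt.coe_add,
    PadicInt.coe_natCast]

theorem poch_eq_unitPoch_mul_of_le (α : ℤ_[p]) {v : ℕ} (hv : v ≤ p) :
    poch α v = ((unitPoch α v : ℤ_[p]) : ℚ_[p]) *
      if digitZero α < v then p * (dworkPrime α : ℚ_[p]) else 1 := by
  have h : ∏ k ∈ Finset.range v, (α + (k : ℤ_[p]))
      = unitPoch α v * if digitZero α < v then p * dworkPrime α else 1 := by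
    rw [Finset.prod_congr rfl fun k hk =>
      add_natCast_eq_unitPart_mul α ((Finset.mem_range.1 hk).trans_le hv), Finset.prod_mul_distrib,
      Finset.prod_ite_eq']
    simp only [unitPoch, Units.coe_prod, Finset.mem_range]
  have hcoe : poch α v = (∏ k ∈ Finset.range v, (α + (k : ℤ_[p])) : ℤ_[p]) := by
    simp only [poch, coe_prod, PadicInt.coe_add, PadicInt.coe_natCast]
  rw [hcoe, h]
  split_ifs <;> simp

theorem poch_mul (α : ℤ_[p]) (z : ℕ) :
    poch α (p * z) = ((unitPoch α (p * z) : ℤ_[p]) : ℚ_[p]) * (p ^ z * poch (dworkPrime α) z) := by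
  induction z with
  | zero => simp [poch, unitPoch]
  | succ z ih =>
    rw [mul_add_one, poch_add, ih, unitPoch_add, poch_add (dworkPrime α) z 1,
      poch_eq_unitPoch_mul_of_le _ le_rfl, if_pos (digitZero_lt _), dworkPrime_add_natCast_mul,
      pow_succ]
    simp only [poch, Finset.range_one, Finset.prod_singleton, Nat.cast_zero, add_zero,
      Units.val_mul, PadicInt.coe_mul]
    ring

theorem poch_add_mul (α : ℤ_[p]) {v : ℕ} (hv : v ≤ p) (z : ℕ) :
    poch α (v + p * z) = ((unitPoch α (v + p * z) : ℤ_[p]) : ℚ_[p]) *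
      (p ^ z * poch (dworkPrime α) z) *
        if digitZero α < v then p * ((dworkPrime α : ℚ_[p]) + z) else 1 := by
  rw [add_comm, poch_add, poch_mul, unitPoch_add, poch_eq_unitPoch_mul_of_le _ hv,
    digitZero_add_natCast_mul, dworkPrime_add_natCast_mul]
  push_cast
  ring

/-- The ratio of the unit parts of `(α)_n` and `(1)_n = n!`. -/
def unitRatio (α : ℤ_[p]) (n : ℕ) : ℤ_[p]ˣ := unitPoch α n * (unitPoch 1 n)⁻¹

theorem unitRatio_one (n : ℕ) : unitRatio (1 : ℤ_[p]) n = 1 := mul_inv_cancel _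

theorem pow_succ_dvd_unitRatio_sub {x y : ℤ_[p]} {n : ℕ} (h : (p : ℤ_[p]) ^ (n + 1) ∣ x - y)
    (m : ℕ) : (p : ℤ_[p]) ^ (n + 1) ∣ (unitRatio x m : ℤ_[p]) - unitRatio y m := by
  simp only [unitRatio, Units.val_mul, ← sub_mul]
  exact (pow_succ_dvd_unitPoch_sub h m).mul_right _

theorem isLip_unitRatio_add_mul {α : ℤ_[p]}
    (h : IsLip p 1 fun z => (unitRatio α (p * z) : ℤ_[p])) (v : ℕ) :
    IsLip p 1 fun z => (unitRatio α (v + p * z) : ℤ_[p]) := by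
  have hsplit : ∀ z, (unitRatio α (v + p * z) : ℤ_[p]) = unitRatio α (p * z) *
      (unitPoch (α + ((p * z : ℕ) : ℤ_[p])) v *
        ((unitPoch (1 + ((p * z : ℕ) : ℤ_[p])) v)⁻¹ : ℤ_[p]ˣ).val) := fun z => by
    rw [add_comm, unitRatio, unitRatio, unitPoch_add, unitPoch_add, mul_inv]
    push_cast
    ring
  simp only [hsplit]
  exact h.mul ((isLip_unitPoch_add_natCast_mul α v).mul (isLip_unitPoch_add_natCast_mul 1 v).inv)

/-- The generalized binomial coefficient `(α)_n / n!`. -/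
def pochRatio (α : ℤ_[p]) (n : ℕ) : ℚ_[p] := poch α n / poch 1 n

theorem pochRatio_add_mul (α : ℤ_[p]) {v : ℕ} (hv : v < p) (z : ℕ) :
    pochRatio α (v + p * z) = ((unitRatio α (v + p * z) : ℤ_[p]) : ℚ_[p]) *
      pochRatio (dworkPrime α) z *
        if digitZero α < v then p * ((dworkPrime α : ℚ_[p]) + z) else 1 := by
  have hp : (p : ℚ_[p]) ^ z ≠ 0 :=
    pow_ne_zero _ (Nat.cast_ne_zero.2 (Fact.out : p.Prime).ne_zero)
  rw [pochRatio, pochRatio, poch_add_mul α hv.le, poch_add_mul 1 hv.le, digitZero_one,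
    if_neg (Nat.le_sub_one_of_lt hv).not_gt, dworkPrime_one, unitRatio, Units.val_mul,
    PadicInt.coe_mul, coe_units_inv, mul_one, mul_right_comm, mul_div_mul_comm,
    mul_div_mul_left _ _ hp]
  ring

end

/-! ### Logarithmic derivatives and their limits -/

section LogDeriv

variable {Q : Type*} [CommRing Q] {p : ℕ} {f g : ℕ → Q} {ℓ m : Q}

/-- `f l = 1 + p l Φ(l)` for a `p`-adically Lipschitz `Φ` with `Φ(0) = ℓ`; thus `p ℓ` is the
logarithmic derivative at `0` of the interpolation of `f` to a function on `ℤ_p`. -/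
def HasLogDeriv (p : ℕ) (f : ℕ → Q) (ℓ : Q) : Prop :=
  ∃ Φ : ℕ → Q, (∀ l, f l = 1 + p * l * Φ l) ∧ IsLip p 0 Φ ∧ Φ 0 = ℓ

theorem HasLogDeriv.isLip (hf : HasLogDeriv p f ℓ) : IsLip p 1 f := by
  obtain ⟨Φ, hfΦ, hΦ, -⟩ := hf
  have hfun : f = fun l => 1 + (p : Q) ^ 1 * (l * Φ l) := by funext l; rw [hfΦ]; ring
  rw [hfun]
  exact (IsLip.const p 1 1).add ((isLip_natCast.mul hΦ).pow_mul 1)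

theorem HasLogDeriv.apply_zero (hf : HasLogDeriv p f ℓ) : f 0 = 1 := by
  obtain ⟨Φ, hfΦ, -⟩ := hf
  simp [hfΦ]

theorem HasLogDeriv.one : HasLogDeriv p (fun _ => (1 : Q)) 0 :=
  ⟨fun _ => 0, by simp, IsLip.const _ _ _, rfl⟩

theorem HasLogDeriv.mul (hf : HasLogDeriv p f ℓ) (hg : HasLogDeriv p g m) :
    HasLogDeriv p (fun l => f l * g l) (ℓ + m) := by
  have hg₁ := hg.apply_zero
  have hg₂ := hg.isLip
  obtain ⟨Φ, hfΦ, hΦ, rfl⟩ := hf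
  obtain ⟨Ψ, hgΨ, hΨ, rfl⟩ := hg
  exact ⟨fun l => Φ l * g l + Ψ l, fun l => by linear_combination hfΦ l * g l + hgΨ l,
    (hΦ.mul (hg₂.mono zero_le_one)).add hΨ, by simp only [hg₁, mul_one]⟩

theorem HasLogDeriv.inv {u : ℕ → Qˣ} (hu : HasLogDeriv p (fun l => (u l : Q)) ℓ) :
    HasLogDeriv p (fun l => ((u l)⁻¹ : Qˣ).val) (-ℓ) := by
  have hu₁ : u 0 = 1 := Units.ext hu.apply_zero
  have hu₂ := hu.isLip.inv
  obtain ⟨Φ, huΦ, hΦ, rfl⟩ := hu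
  refine ⟨fun l => -(Φ l * ((u l)⁻¹ : Qˣ).val), fun l => ?_,
    (hΦ.mul (hu₂.mono zero_le_one)).neg, by simp [hu₁]⟩
  linear_combination (u l).mul_inv - ((u l)⁻¹ : Qˣ).val * huΦ l

theorem HasLogDeriv.prod {ι : Type*} (s : Finset ι) {f : ι → ℕ → Q} {ℓ : ι → Q}
    (h : ∀ i ∈ s, HasLogDeriv p (f i) (ℓ i)) :
    HasLogDeriv p (fun l => ∏ i ∈ s, f i l) (∑ i ∈ s, ℓ i) := by
  classical
  induction s using Finset.induction_on with
  | empty => simpa using HasLogDeriv.one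
  | insert i s hi ih =>
    simp only [Finset.prod_insert hi, Finset.sum_insert hi]
    exact (h i (Finset.mem_insert_self i s)).mul
      (ih fun j hj => h j (Finset.mem_insert_of_mem hj))

theorem HasLogDeriv.one_add_sum {ι : Type*} (s : Finset ι) {g : ι → ℕ → Q} {ℓ : ι → Q}
    (h : ∀ i ∈ s, HasLogDeriv p (fun l => 1 + g i l) (ℓ i)) :
    HasLogDeriv p (fun l => 1 + ∑ i ∈ s, g i l) (∑ i ∈ s, ℓ i) := by
  choose! Φ hgΦ hΦ hΦ₀ using h
  refine ⟨fun l => ∑ i ∈ s, Φ i l, fun l => ?_, IsLip.sum s hΦ, Finset.sum_congr rfl hΦ₀⟩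
  rw [Finset.mul_sum]
  exact congrArg (1 + ·) (Finset.sum_congr rfl fun i hi => add_left_cancel (hgΦ i hi l))

theorem HasLogDeriv.map {Q' : Type*} [CommRing Q'] (φ : Q →+* Q') (hf : HasLogDeriv p f ℓ) :
    HasLogDeriv p (fun l => φ (f l)) (φ ℓ) := by
  obtain ⟨Φ, hfΦ, hΦ, rfl⟩ := hf
  exact ⟨fun l => φ (Φ l), fun l => by simp [hfΦ], hΦ.map φ, rfl⟩

end LogDeriv

section Complete

variable {Q : Type*} [CommRing Q] {p : ℕ}

theorem pow_dvd_of_pow_add_dvd_mul [IsDomain Q] {a x : Q} {s j : ℕ} (hp : (p : Q) ≠ 0)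
    (ha : a ∣ (p : Q) ^ s) (h : (p : Q) ^ (j + s) ∣ a * x) : (p : Q) ^ j ∣ x := by
  obtain ⟨y, hy⟩ := ha
  have ha₀ : a ≠ 0 := by rintro rfl; exact pow_ne_zero s hp (by rw [hy, zero_mul])
  refine dvd_of_mul_right_dvd (a := (p : Q) ^ j) (b := y) ((mul_dvd_mul_iff_left ha₀).1 ?_)
  rwa [mul_left_comm, ← hy, ← pow_add]

theorem HasLogDeriv.pow_dvd_sub [IsDomain Q] (hp : (p : Q) ≠ 0) {f g : ℕ → Q} {ℓ m : Q}
    (hf : HasLogDeriv p f ℓ) (hg : HasLogDeriv p g m) {j : ℕ}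
    (h : (p : Q) ^ (2 * j + 1) ∣ f (p ^ j) - g (p ^ j)) : (p : Q) ^ j ∣ ℓ - m := by
  obtain ⟨Φ, hfΦ, hΦ, rfl⟩ := hf
  obtain ⟨Ψ, hgΨ, hΨ, rfl⟩ := hg
  have hj : p ^ j ≡ 0 [MOD p ^ j] := by simp [Nat.ModEq]
  have hΦΨ : (p : Q) ^ j ∣ Φ (p ^ j) - Ψ (p ^ j) := by
    refine pow_dvd_of_pow_add_dvd_mul hp (a := (p : Q) * (p ^ j : ℕ)) (s := j + 1) ?_ ?_
    · push_cast; exact (pow_succ' _ _).symm.dvd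
    · rw [hfΦ, hgΨ, add_sub_add_left_eq_sub, ← mul_sub] at h
      rwa [← add_assoc, ← two_mul]
  rw [show Φ 0 - Ψ 0 = Φ (p ^ j) - Ψ (p ^ j) - (Φ (p ^ j) - Φ 0) + (Ψ (p ^ j) - Ψ 0) by ring]
  exact dvd_add (dvd_sub hΦΨ (hΦ hj)) (hΨ hj)

theorem smodEq_span_pow_iff {x y a : Q} {n : ℕ} :
    x ≡ y [SMOD (Ideal.span {a} ^ n • ⊤ : Submodule Q Q)] ↔ a ^ n ∣ x - y := by
  rw [SModEq.sub_mem, smul_eq_mul, Ideal.mul_top, Ideal.span_singleton_pow,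
    Ideal.mem_span_singleton]

theorem eq_of_forall_pow_dvd_sub [IsHausdorff (Ideal.span {(p : Q)}) Q] {x y : Q}
    (h : ∀ n, (p : Q) ^ n ∣ x - y) : x = y :=
  (IsHausdorff.eq_iff_smodEq (I := Ideal.span {(p : Q)})).2 fun n => smodEq_span_pow_iff.2 (h n)

theorem exists_forall_pow_dvd_sub [IsPrecomplete (Ideal.span {(p : Q)}) Q] {u : ℕ → Q}
    (hu : ∀ j, ∃ i₀, ∀ i ≥ i₀, (p : Q) ^ j ∣ u i - u i₀) :
    ∃ x, ∀ j, ∀ᶠ i in atTop, (p : Q) ^ j ∣ x - u i := by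
  choose i₀ hi₀ using hu
  let I : ℕ → ℕ := fun j => (Finset.range (j + 1)).sup i₀
  have hI {m n : ℕ} (hmn : m ≤ n) : i₀ m ≤ I n :=
    Finset.le_sup (Finset.mem_range.2 (Nat.lt_succ_of_le hmn))
  obtain ⟨x, hx⟩ := IsPrecomplete.prec (I := Ideal.span {(p : Q)}) inferInstance
    (f := fun j => u (I j)) fun {m n} hmn => by
      rw [smodEq_span_pow_iff, ← sub_sub_sub_cancel_right _ _ (u (i₀ m))]
      exact dvd_sub (hi₀ m _ (hI le_rfl)) (hi₀ m _ (hI hmn))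
  refine ⟨x, fun j => (eventually_ge_atTop (i₀ j)).mono fun i hi => ?_⟩
  have hxj : (p : Q) ^ j ∣ u (I j) - x := smodEq_span_pow_iff.1 (hx j)
  rw [show x - u i = u (I j) - u (i₀ j) - (u i - u (i₀ j)) - (u (I j) - x) by ring]
  exact dvd_sub (dvd_sub (hi₀ j _ (hI le_rfl)) (hi₀ j i hi)) hxj

theorem isUnit_natCast_of_not_dvd [IsAdicComplete (Ideal.span {(p : Q)}) Q] (hp : p.Prime)
    {n : ℕ} (hn : ¬ p ∣ n) : IsUnit (n : Q) := by
  have hpJ : (p : Q) ∈ Ideal.jacobson (⊥ : Ideal Q) :=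
    IsAdicComplete.le_jacobson_bot (Ideal.span {(p : Q)}) (Ideal.mem_span_singleton_self _)
  obtain ⟨x, y, hxy⟩ := Nat.isCoprime_iff_coprime.2 ((hp.coprime_iff_not_dvd).2 hn)
  have hbezout : (y : Q) * n = p * (-x : Q) + 1 := by
    have := congrArg (Int.cast : ℤ → Q) hxy
    push_cast at this
    linear_combination this
  refine isUnit_of_mul_isUnit_right (x := (y : Q)) ?_
  rw [hbezout]
  exact Ideal.mem_jacobson_bot.1 hpJ _

theorem natCast_dvd_pow_padicValNat [IsAdicComplete (Ideal.span {(p : Q)}) Q] (hp : p.Prime)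
    {n : ℕ} (hn : n ≠ 0) : (n : Q) ∣ (p : Q) ^ padicValNat p n := by
  have hunit : IsUnit ((n / p ^ n.factorization p : ℕ) : Q) :=
    isUnit_natCast_of_not_dvd hp (Nat.not_dvd_ordCompl hp hn)
  nth_rw 1 [← Nat.ordProj_mul_ordCompl_eq_self n p]
  rw [Nat.cast_mul, hunit.mul_right_dvd, Nat.cast_pow, Nat.factorization_def n hp]

theorem exists_hasLogDeriv_of_forall_pow_dvd_sub [IsDomain Q]
    [IsAdicComplete (Ideal.span {(p : Q)}) Q] (hp : p.Prime) (hp₀ : (p : Q) ≠ 0)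
    {f : ℕ → Q} {F : ℕ → ℕ → Q} {ℓ : ℕ → Q} (hF : ∀ i, HasLogDeriv p (F i) (ℓ i))
    (hfF : ∀ i l, (p : Q) ^ i ∣ f l - F i l) : ∃ ℓ', HasLogDeriv p f ℓ' := by
  have hFF {i i' n : ℕ} (l : ℕ) (hi : n ≤ i) (hi' : n ≤ i') :
      (p : Q) ^ n ∣ F i l - F i' l := by
    rw [← sub_sub_sub_cancel_left _ _ (f l)]
    exact dvd_sub ((pow_dvd_pow _ hi').trans (hfF i' l)) ((pow_dvd_pow _ hi).trans (hfF i l))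
  choose Φ hFΦ hΦ hΦ₀ using id hF
  have hcauchy (l j : ℕ) : ∃ i₀, ∀ i ≥ i₀, (p : Q) ^ j ∣ Φ i l - Φ i₀ l := by
    rcases eq_or_ne l 0 with rfl | hl
    · refine ⟨2 * j + 1, fun i hi => ?_⟩
      rw [hΦ₀, hΦ₀]
      exact (hF i).pow_dvd_sub hp₀ (hF _) (hFF _ hi le_rfl)
    · have hpl := natCast_dvd_pow_padicValNat (Q := Q) hp (mul_ne_zero hp.ne_zero hl)
      refine ⟨j + padicValNat p (p * l), fun i hi => pow_dvd_of_pow_add_dvd_mul hp₀ hpl ?_⟩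
      have := hFF l hi le_rfl
      rwa [hFΦ, hFΦ, add_sub_add_left_eq_sub, ← mul_sub, ← Nat.cast_mul] at this
  choose Ψ hΨ using fun l => exists_forall_pow_dvd_sub (hcauchy l)
  refine ⟨Ψ 0, Ψ, fun l => eq_of_forall_pow_dvd_sub (p := p) fun n => ?_, fun k z z' hz => ?_, rfl⟩
  · obtain ⟨i, hi, hni⟩ := ((hΨ l n).and (eventually_ge_atTop n)).exists
    have hfi := (pow_dvd_pow (p : Q) hni).trans (hfF i l)
    rw [show f l - (1 + p * l * Ψ l) = f l - F i l - p * l * (Ψ l - Φ i l) by rw [hFΦ]; ring]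
    exact dvd_sub hfi (hi.mul_left _)
  · obtain ⟨i, hz₁, hz₂⟩ := ((hΨ z (k + 0)).and (hΨ z' (k + 0))).exists
    rw [show Ψ z - Ψ z' = Ψ z - Φ i z + (Φ i z - Φ i z') - (Ψ z' - Φ i z') by ring]
    exact dvd_sub (dvd_add hz₁ (hΦ i hz)) hz₂

end Complete

section Binomial

variable {Q : Type*} [CommRing Q] {p : ℕ}

theorem natCast_mul_prod_sub_eq_factorial_mul_choose (l k : ℕ) :
    (l : Q) * ∏ j ∈ Finset.range k, ((l : Q) - (j + 1)) = (k + 1).factorial * l.choose (k + 1) := by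
  rw [← Nat.cast_mul, ← Nat.descFactorial_eq_factorial_mul_choose,
    ← descPochhammer_eval_eq_descFactorial, descPochhammer_eval_eq_prod_range,
    Finset.prod_range_succ']
  push_cast
  ring

theorem exists_hasLogDeriv_one_add_choose [IsAdicComplete (Ideal.span {(p : Q)}) Q]
    (hp : p.Prime) (w : Q) (k : ℕ) :
    ∃ c, HasLogDeriv p (fun l => 1 + (p * w) ^ (k + 1) * l.choose (k + 1)) c ∧
      c * (k + 1) = (-1) ^ k * p ^ k * w ^ (k + 1) := by
  have : Fact p.Prime := ⟨hp⟩
  obtain ⟨κ, hκ⟩ : ((k + 1).factorial : Q) ∣ (p : Q) ^ k :=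
    (natCast_dvd_pow_padicValNat hp (Nat.factorial_ne_zero _)).trans
      (pow_dvd_pow _ (Nat.le_of_lt_succ (padicValNat_factorial_lt_of_ne_zero p k.succ_ne_zero)))
  refine ⟨_, ⟨fun l => κ * w ^ (k + 1) * ∏ j ∈ Finset.range k, ((l : Q) - (j + 1)), fun l => ?_,
    (IsLip.const p 0 _).mul (IsLip.prod _ fun j _ => ?_), rfl⟩, ?_⟩
  · linear_combination -(p * κ * w ^ (k + 1)) *
      natCast_mul_prod_sub_eq_factorial_mul_choose (Q := Q) l k +
        p * w ^ (k + 1) * (l.choose (k + 1)) * hκ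
  · simpa only [sub_eq_add_neg] using isLip_natCast.add (IsLip.const p 0 _)
  · have hfact : ∏ j ∈ Finset.range k, (((0 : ℕ) : Q) - (j + 1)) = (-1) ^ k * k.factorial := by
      simp only [Nat.cast_zero, zero_sub, Finset.prod_neg, Finset.card_range]
      rw [← Finset.prod_range_add_one_eq_factorial]
      push_cast
      rfl
    rw [Nat.factorial_succ] at hκ
    push_cast at hκ
    simp only [hfact]
    linear_combination -(-1) ^ k * w ^ (k + 1) * hκ

theorem pow_dvd_one_add_pow_sub (x : Q) (l N : ℕ) :
    x ^ N ∣ (1 + x) ^ l - ∑ k ∈ Finset.range N, x ^ k * l.choose k := by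
  have hexpand : (1 + x) ^ l = ∑ k ∈ Finset.range (N + (l + 1)), x ^ k * l.choose k := by
    rw [add_comm, add_pow]
    simp only [one_pow, mul_one]
    refine Finset.sum_subset (Finset.range_mono (Nat.le_add_left _ _)) fun k _ hk => ?_
    rw [Nat.choose_eq_zero_of_lt (by simpa using hk), Nat.cast_zero, mul_zero]
  rw [hexpand, Finset.sum_range_add, add_sub_cancel_left]
  exact Finset.dvd_sum fun k _ => (pow_dvd_pow x (Nat.le_add_right N k)).mul_right _

theorem exists_hasLogDeriv_one_add_mul_pow [IsDomain Q] [IsAdicComplete (Ideal.span {(p : Q)}) Q]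
    (hp : p.Prime) (hp₀ : (p : Q) ≠ 0) (w : Q) :
    ∃ (ℓ : Q) (c : ℕ → Q), HasLogDeriv p (fun l => (1 + p * w) ^ l) ℓ ∧
      (∀ k, c k * (k + 1) = (-1) ^ k * p ^ k * w ^ (k + 1)) ∧
      ∀ n, ∀ M ≥ 2 * n + 1, (p : Q) ^ n ∣ ∑ k ∈ Finset.range M, c k - ℓ := by
  choose c hc hc_mul using exists_hasLogDeriv_one_add_choose hp w
  have hF (M : ℕ) := HasLogDeriv.one_add_sum (Finset.range M) fun k _ => hc k
  have hfF (M l : ℕ) : (p : Q) ^ M ∣ (1 + p * w) ^ l -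
      (1 + ∑ k ∈ Finset.range M, (p * w) ^ (k + 1) * (l.choose (k + 1) : Q)) := by
    have h := pow_dvd_one_add_pow_sub (p * w) l (M + 1)
    rw [Finset.sum_range_succ', pow_zero, one_mul, Nat.choose_zero_right, Nat.cast_one,
      add_comm _ (1 : Q)] at h
    exact ((pow_dvd_pow_of_dvd (dvd_mul_right _ w) M).trans (pow_dvd_pow _ M.le_succ)).trans h
  obtain ⟨ℓ, hℓ⟩ := exists_hasLogDeriv_of_forall_pow_dvd_sub hp hp₀ hF hfF
  refine ⟨ℓ, c, hℓ, hc_mul, fun n M hM => ?_⟩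
  rw [dvd_sub_comm]
  exact hℓ.pow_dvd_sub hp₀ (hF M) ((pow_dvd_pow _ hM).trans (hfF M _))

end Binomial

section PadicLimit

variable (p : ℕ) [Fact p.Prime]

theorem natCast_W_ne_zero {n : ℕ} (hn : n ≠ 0) : (n : W p) ≠ 0 := by
  rw [← map_natCast (zpToW p), Ne, map_eq_zero_iff _ (zpToW_injective p)]
  exact_mod_cast hn

theorem natCast_K_ne_zero {n : ℕ} (hn : n ≠ 0) : (n : K p) ≠ 0 := by
  rw [← map_natCast (algebraMap (W p) (K p)), Ne,
    map_eq_zero_iff _ (IsFractionRing.injective (W p) (K p))]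
  exact natCast_W_ne_zero p hn

theorem qpToK_coe (x : ℤ_[p]) : qpToK p x = algebraMap (W p) (K p) (zpToW p x) :=
  IsFractionRing.lift_algebraMap (A := ℤ_[p]) (K := ℚ_[p])
    (g := (algebraMap (W p) (K p)).comp (zpToW p))
    ((IsFractionRing.injective (W p) (K p)).comp (zpToW_injective p)) x

theorem padicAbs_natCast_lt_one : padicAbs p (algebraMap (W p) (K p) p) < 1 := by
  rw [padicAbs, IsDedekindDomain.HeightOneSpectrum.adicAbv_coe_lt_one_iff]
  exact (IsLocalRing.mem_maximalIdeal _).2 (WittVector.irreducible p).not_isUnit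

variable {p}

theorem padicAbs_le_pow {x : W p} {n : ℕ} (h : (p : W p) ^ n ∣ x) :
    padicAbs p (algebraMap (W p) (K p) x) ≤ padicAbs p (algebraMap (W p) (K p) p) ^ n := by
  obtain ⟨y, rfl⟩ := h
  rw [map_mul, map_mul, map_pow, map_pow]
  exact mul_le_of_le_one_right (pow_nonneg ((padicAbs p).nonneg _) _)
    (IsDedekindDomain.HeightOneSpectrum.adicAbv_coe_le_one _ _ _)

theorem isUnit_of_padicAbs_eq_one {x : W p} (h : padicAbs p (algebraMap (W p) (K p) x) = 1) :
    IsUnit x := by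
  rw [padicAbs, IsDedekindDomain.HeightOneSpectrum.adicAbv_coe_eq_one_iff] at h
  by_contra hx
  exact h ((IsLocalRing.mem_maximalIdeal _).2 hx)

theorem isPadicLimit_of_dvd {u : ℕ → W p} {x : W p}
    (h : ∀ n : ℕ, ∀ᶠ m in atTop, (p : W p) ^ n ∣ u m - x) :
    IsPadicLimit p (fun m => algebraMap (W p) (K p) (u m)) (algebraMap (W p) (K p) x) := by
  refine (nhds_basis_abs_sub_lt (0 : ℝ)).tendsto_right_iff.2 fun ε hε => ?_
  obtain ⟨n, hn⟩ := exists_pow_lt_of_lt_one hε (padicAbs_natCast_lt_one p)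
  filter_upwards [h n] with m hm
  rw [sub_zero, abs_of_nonneg ((padicAbs p).nonneg _), ← map_sub]
  exact (padicAbs_le_pow hm).trans_lt hn

theorem IsPadicLimit.unique {u : ℕ → K p} {x y : K p} (hx : IsPadicLimit p u x)
    (hy : IsPadicLimit p u y) : x = y := by
  have hle : padicAbs p (x - y) ≤ 0 := by
    refine ge_of_tendsto' (by simpa using hx.add hy) fun m => ?_
    rw [(padicAbs p).map_sub (u m) x]
    exact (padicAbs p).sub_le x (u m) y
  exact sub_eq_zero.1 ((padicAbs p).eq_zero.1 (hle.antisymm ((padicAbs p).nonneg _)))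

theorem logK_eq_of_isPadicLimit {z x : K p} (h : IsPadicLimit p
    (fun m => -∑ n ∈ Finset.range m, (1 - z) ^ (n + 1) / ((n : K p) + 1)) x) : logK p z = x := by
  have hex := Exists.intro x h
  rw [logK, dif_pos hex]
  exact hex.choose_spec.unique h

theorem exists_hasLogDeriv_and_eq_logK (w : W p) :
    ∃ ℓ, HasLogDeriv p (fun l => (1 + p * w) ^ l) ℓ ∧
      algebraMap (W p) (K p) (p * ℓ) = logK p (algebraMap (W p) (K p) (1 + p * w)) := by
  have hp : p.Prime := Fact.out
  obtain ⟨ℓ, c, hℓ, hc, hcℓ⟩ :=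
    exists_hasLogDeriv_one_add_mul_pow hp (natCast_W_ne_zero p hp.ne_zero) w
  have hpartial (M : ℕ) : -∑ k ∈ Finset.range M,
      (1 - algebraMap (W p) (K p) (1 + p * w)) ^ (k + 1) / ((k : K p) + 1)
        = algebraMap (W p) (K p) (p * ∑ k ∈ Finset.range M, c k) := by
    rw [Finset.mul_sum, map_sum, ← Finset.sum_neg_distrib]
    refine Finset.sum_congr rfl fun k _ => ?_
    have hk : (k : K p) + 1 ≠ 0 := by exact_mod_cast natCast_K_ne_zero p k.succ_ne_zero
    have hck := congrArg (algebraMap (W p) (K p)) (hc k)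
    simp only [map_mul, map_add, map_natCast, map_pow, map_neg, map_one] at hck ⊢
    rw [← neg_div, div_eq_iff hk, sub_add_cancel_left, neg_pow, mul_pow]
    linear_combination -(p : K p) * hck
  refine ⟨ℓ, hℓ, (logK_eq_of_isPadicLimit ?_).symm⟩
  simp only [hpartial]
  refine isPadicLimit_of_dvd fun n => (eventually_ge_atTop (2 * n + 1)).mono fun M hM => ?_
  rw [← mul_sub]
  exact (hcℓ n M hM).mul_left _

end PadicLimit

section Digamma

variable {p : ℕ} [Fact p.Prime]

theorem unitRatio_succ (α : ℤ_[p]) (n : ℕ) :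
    unitRatio (α + 1) n * unitPart α = unitRatio α n * unitPart (α + (n : ℤ_[p])) := by
  rw [unitRatio, unitRatio, mul_right_comm, unitPoch_add_one_mul, mul_right_comm]

theorem unitRatio_natCast {n : ℕ} (hn : 1 ≤ n) (m : ℕ) :
    unitRatio (n : ℤ_[p]) m = ∏ k ∈ Finset.Ico 1 n,
      unitPart ((k : ℤ_[p]) + (m : ℤ_[p])) * (unitPart (k : ℤ_[p]))⁻¹ := by
  induction n, hn using Nat.le_induction with
  | base => simp [unitRatio_one]
  | succ n hn ih =>
    rw [Finset.prod_Ico_succ_top hn, ← ih, ← mul_assoc, eq_mul_inv_iff_mul_eq, Nat.cast_succ,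
      unitRatio_succ]

theorem hasLogDeriv_unitPart_add_mul (k : ℕ) :
    HasLogDeriv p (fun h => ((unitPart ((k : ℤ_[p]) + ((p * h : ℕ) : ℤ_[p])) *
      (unitPart (k : ℤ_[p]))⁻¹ : ℤ_[p]ˣ) : ℤ_[p]))
      (if p ∣ k then 0 else ((unitPart (k : ℤ_[p]))⁻¹ : ℤ_[p]ˣ).val) := by
  have hdvd (h : ℕ) : p ∣ k + p * h ↔ p ∣ k := Nat.dvd_add_left (dvd_mul_right _ _)
  simp only [← Nat.cast_add]
  split_ifs with hk
  · have hone (n : ℕ) (hn : p ∣ n) : unitPart (n : ℤ_[p]) = 1 :=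
      unitPart_of_not_isUnit (by rwa [isUnit_natCast_iff, not_not])
    simpa only [hone k hk, hone _ ((hdvd _).2 hk), mul_inv_cancel, Units.val_one] using
      HasLogDeriv.one (p := p)
  · have hself (n : ℕ) (hn : ¬ p ∣ n) : (unitPart (n : ℤ_[p]) : ℤ_[p]) = n :=
      unitPart_of_isUnit ((isUnit_natCast_iff n).2 hn)
    refine ⟨fun _ => ((unitPart (k : ℤ_[p]))⁻¹ : ℤ_[p]ˣ).val, fun h => ?_, IsLip.const p 0 _, rfl⟩
    have hinv := (unitPart (k : ℤ_[p])).mul_inv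
    rw [hself k hk] at hinv
    simp only [Units.val_mul, hself _ (mt (hdvd h).1 hk)]
    push_cast
    linear_combination hinv

theorem hasLogDeriv_unitRatio_natCast {n : ℕ} (hn : 1 ≤ n) :
    HasLogDeriv p (fun h => (unitRatio (n : ℤ_[p]) (p * h) : ℤ_[p]))
      (∑ k ∈ (Finset.Ico 1 n).filter (fun k => ¬ p ∣ k),
        ((unitPart (k : ℤ_[p]))⁻¹ : ℤ_[p]ˣ).val) := by
  simp only [unitRatio_natCast hn, Units.coe_prod, Finset.sum_filter, ite_not]
  exact HasLogDeriv.prod _ fun k _ => hasLogDeriv_unitPart_add_mul k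

theorem nhds_hasBasis_pow_dvd (α : ℤ_[p]) :
    (𝓝 α).HasBasis (fun _ : ℕ => True) fun n => {x | (p : ℤ_[p]) ^ n ∣ x - α} := by
  have hp : 1 < (p : ℝ) := by exact_mod_cast (Fact.out : p.Prime).one_lt
  refine (Metric.nhds_basis_closedBall_pow (inv_pos.2 (zero_lt_one.trans hp))
    (inv_lt_one_of_one_lt₀ hp)).congr (fun _ => Iff.rfl) fun n _ => Set.ext fun x => ?_
  rw [mem_closedBall_iff_norm, inv_pow, ← zpow_natCast, ← zpow_neg,
    PadicInt.norm_le_pow_iff_mem_span_pow, Ideal.mem_span_singleton]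
  rfl

theorem exists_pos_natCast_sub_dvd (α : ℤ_[p]) (i : ℕ) :
    ∃ n : ℕ, 1 ≤ n ∧ (p : ℤ_[p]) ^ i ∣ n - α := by
  refine ⟨α.appr i + p ^ i, Nat.le_add_left_of_le (Nat.pow_pos (Fact.out : p.Prime).pos), ?_⟩
  rw [Nat.cast_add, add_sub_right_comm, Nat.cast_pow, dvd_add_self_right, dvd_sub_comm]
  exact Ideal.mem_span_singleton.1 (PadicInt.appr_spec i α)

theorem psiTilde_eq_of_forall_dvd {α y : ℤ_[p]}
    (h : ∀ (n j : ℕ), 1 ≤ n → (p : ℤ_[p]) ^ (2 * j + 1) ∣ n - α →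
      (p : ℤ_[p]) ^ j ∣ ∑ k ∈ (Finset.Ico 1 n).filter (fun k => ¬ p ∣ k),
        ((unitPart (k : ℤ_[p]))⁻¹ : ℤ_[p]ˣ).val - y) : psiTilde α = y := by
  have hbasis := ((nhds_hasBasis_pow_dvd α).comap (fun n : ℕ => (n : ℤ_[p]))).inf_principal
    {n : ℕ | 0 < n}
  have : (comap (fun n : ℕ => (n : ℤ_[p])) (𝓝 α) ⊓ 𝓟 {n : ℕ | 0 < n}).NeBot :=
    hbasis.neBot_iff.2 fun {i} _ =>
      let ⟨n, hn, hnα⟩ := exists_pos_natCast_sub_dvd α i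
      ⟨n, hnα, hn⟩
  have hcoe (n : ℕ) : ∑ k ∈ (Finset.Ico 1 n).filter (fun k => ¬ p ∣ k), (k : ℚ_[p])⁻¹ =
      (∑ k ∈ (Finset.Ico 1 n).filter (fun k => ¬ p ∣ k),
        ((unitPart (k : ℤ_[p]))⁻¹ : ℤ_[p]ˣ).val : ℤ_[p]) := by
    rw [PadicInt.coe_sum]
    refine Finset.sum_congr rfl fun k hk => ?_
    rw [coe_units_inv, unitPart_of_isUnit ((isUnit_natCast_iff k).2 (Finset.mem_filter.1 hk).2),
      PadicInt.coe_natCast]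
  simp only [psiTilde, hcoe]
  refine Tendsto.limUnder_eq ((continuous_subtype_val.tendsto y).comp ?_)
  exact (hbasis.tendsto_iff (nhds_hasBasis_pow_dvd y)).2 fun j _ =>
    ⟨2 * j + 1, trivial, fun n hn => h n j hn.2 hn.1⟩

theorem exists_hasLogDeriv_unitRatio (α : ℤ_[p]) :
    ∃ y : ℤ_[p], HasLogDeriv p (fun h => (unitRatio α (p * h) : ℤ_[p])) y ∧
      psiTilde α = y := by
  have hp : p.Prime := Fact.out
  have hp₀ : (p : ℤ_[p]) ≠ 0 := Nat.cast_ne_zero.2 hp.ne_zero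
  have : IsAdicComplete (Ideal.span {(p : ℤ_[p])}) ℤ_[p] :=
    PadicInt.maximalIdeal_eq_span_p (p := p) ▸ inferInstance
  choose n hn hnα using fun i => exists_pos_natCast_sub_dvd α (i + 1)
  obtain ⟨y, hy⟩ := exists_hasLogDeriv_of_forall_pow_dvd_sub hp hp₀
    (fun i => hasLogDeriv_unitRatio_natCast (hn i)) fun i m => by
      rw [dvd_sub_comm]
      exact (pow_dvd_pow _ i.le_succ).trans (pow_succ_dvd_unitRatio_sub (hnα i) _)
  exact ⟨y, hy, psiTilde_eq_of_forall_dvd fun k j hk hkα =>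
    (hasLogDeriv_unitRatio_natCast hk).pow_dvd_sub hp₀ hy (pow_succ_dvd_unitRatio_sub hkα _)⟩

end Digamma

/-! ### The hypergeometric coefficients as a Dwork system -/

theorem card_lt_card_of_interlacing {r v : ℕ} {f : Fin (r + 1) → ℕ} {g : Fin r → ℕ}
    {Q : Fin r → Prop}
    (h : ∀ (ρ : Equiv.Perm (Fin (r + 1))) (τ : Equiv.Perm (Fin r)),
      Monotone (fun i => f (ρ i)) → Monotone (fun j => g (τ j)) →
      ∀ j : Fin r, (j : ℕ) < Nat.card {k // Q k} → f (ρ j.succ) < g (τ j))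
    {S : Finset (Fin r)} (hS : S.Nonempty) (hSQ : ∀ j ∈ S, Q j) (hSg : ∀ j ∈ S, g j ≤ v) :
    S.card < Finset.card {i | f i < v} := by
  classical
  have hpos := hS.card_pos
  have hr : S.card ≤ r := by simpa using S.card_le_univ
  have hQ : S.card ≤ Nat.card {k // Q k} := by
    rw [Nat.card_eq_fintype_card, Fintype.card_subtype]
    exact Finset.card_le_card fun j hj => by simpa using hSQ j hj
  have hcard : ∀ {n : ℕ} (P : Fin n → Prop) [DecidablePred P] (π : Equiv.Perm (Fin n)),
      Finset.card {i | P (π i)} = Finset.card {i | P i} := fun P _ π => by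
    simp only [← Fintype.card_subtype]
    exact Fintype.card_congr (π.subtypeEquiv fun _ => Iff.rfl)
  let j : Fin r := ⟨S.card - 1, by lia⟩
  have hgv : g (Tuple.sort g j) ≤ v := by
    rw [← Tuple.lt_card_le_iff_apply_le_of_monotone (f := fun j => g (Tuple.sort g j))
      (Tuple.monotone_sort g), hcard fun j => g j ≤ v]
    exact (Nat.sub_one_lt hpos.ne').trans_le
      (Finset.card_le_card fun j hj => by simpa using hSg j hj)
  have hfv : f (Tuple.sort f j.succ) < v :=
    (h _ _ (Tuple.monotone_sort f) (Tuple.monotone_sort g) j (by simp only [j]; lia)).trans_le hgv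
  rw [← Tuple.lt_card_lt_iff_apply_lt_of_monotone (f := fun i => f (Tuple.sort f i))
    (Tuple.monotone_sort f), hcard fun i => f i < v] at hfv
  simpa only [j, Fin.val_succ, Nat.sub_add_cancel (Nat.succ_le_of_lt hpos)] using hfv

noncomputable section

variable {p : ℕ} [Fact p.Prime]

section Transition

variable {ι κ : Type*}

theorem prod_add_natCast_eq (b : κ → ℤ_[p]) (S : Finset κ) {v : ℕ} (hv : v < p) (z : ℕ) :
    ∏ j ∈ S, ((b j : ℚ_[p]) + (v + p * z : ℕ))
      = (∏ j ∈ S, ((unitPart (b j + ((p * z : ℕ) : ℤ_[p]) + (v : ℤ_[p])) : ℤ_[p]) : ℚ_[p])) *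
        ∏ j ∈ S with digitZero (b j) = v, p * ((dworkPrime (b j) : ℚ_[p]) + z) := by
  rw [Finset.prod_filter, ← Finset.prod_mul_distrib]
  refine Finset.prod_congr rfl fun j _ => ?_
  have h := add_natCast_eq_unitPart_mul (b j + ((p * z : ℕ) : ℤ_[p])) hv
  rw [digitZero_add_natCast_mul, dworkPrime_add_natCast_mul] at h
  have hcast := congrArg (fun x : ℤ_[p] => (x : ℚ_[p])) h
  simp only [PadicInt.coe_mul, eq_comm (a := v)] at hcast
  rw [show (b j : ℚ_[p]) + (v + p * z : ℕ)
    = (b j + ((p * z : ℕ) : ℤ_[p]) + (v : ℤ_[p]) : ℤ_[p]) by push_cast; ring, hcast]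
  split_ifs <;> simp only [PadicInt.coe_mul, PadicInt.coe_add, PadicInt.coe_natCast,
    PadicInt.coe_one]

variable [Fintype ι] [Fintype κ]

/-- The hypergeometric coefficient divided by `∏_{j ∈ S} (b_j + z)`. When `z` is split into its
last digit and the rest, the factors of the Pochhammer symbols that are divisible by `p` leave
such a product behind, so Dwork's congruences have to be proved for all `S` at once. -/
def hypCoeff (a : ι → ℤ_[p]) (b : κ → ℤ_[p]) (S : Finset κ) (z : ℕ) : ℚ_[p] :=
  (∏ i, pochRatio (a i) z) / ((∏ j, pochRatio (b j) z) * ∏ j ∈ S, ((b j : ℚ_[p]) + z))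

open Classical in
/-- The set of denominators left behind by the digit `v`. -/
def nextState (b : κ → ℤ_[p]) (v : ℕ) (S : Finset κ) : Finset κ :=
  {j | digitZero (b j) < v ∨ j ∈ S ∧ digitZero (b j) = v}

/-- The unit relating `hypCoeff` at `v + p z` to its value at `z` for the Dwork primes. -/
def transitionUnit (a : ι → ℤ_[p]) (b : κ → ℤ_[p]) (S : Finset κ) (v z : ℕ) : ℤ_[p]ˣ :=
  (∏ i, unitRatio (a i) (v + p * z)) *
    ((∏ j, unitRatio (b j) (v + p * z)) *
      ∏ j ∈ S, unitPart (b j + ((p * z : ℕ) : ℤ_[p]) + (v : ℤ_[p])))⁻¹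

theorem isLip_transitionUnit (a : ι → ℤ_[p]) (b : κ → ℤ_[p]) (S : Finset κ) (v : ℕ) :
    IsLip p 1 fun z => (transitionUnit a b S v z : ℤ_[p]) := by
  have hratio (α : ℤ_[p]) : IsLip p 1 fun z => (unitRatio α (v + p * z) : ℤ_[p]) := by
    obtain ⟨y, hy, -⟩ := exists_hasLogDeriv_unitRatio α
    exact isLip_unitRatio_add_mul hy.isLip v
  have hpart (α : ℤ_[p]) :
      IsLip p 1 fun z => (unitPart (α + ((p * z : ℕ) : ℤ_[p]) + (v : ℤ_[p])) : ℤ_[p]) :=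
    fun k z z' h => pow_succ_dvd_unitPart_sub <| by
      simpa using (isLip_natCast (Q := ℤ_[p]).comp_digit 0 h)
  simp only [transitionUnit, Units.val_mul, Units.coe_prod]
  refine (IsLip.prod _ fun i _ => hratio (a i)).mul (IsLip.inv ?_)
  simp only [Units.val_mul, Units.coe_prod]
  exact (IsLip.prod _ fun j _ => hratio (b j)).mul (IsLip.prod _ fun j _ => hpart (b j))

theorem prod_pochRatio_add_mul (a : ι → ℤ_[p]) {v : ℕ} (hv : v < p) (z : ℕ) :
    ∏ i, pochRatio (a i) (v + p * z)
      = (∏ i, ((unitRatio (a i) (v + p * z) : ℤ_[p]) : ℚ_[p])) *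
        (∏ i, pochRatio (dworkPrime (a i)) z) *
          ∏ i with digitZero (a i) < v, p * ((dworkPrime (a i) : ℚ_[p]) + z) := by
  simp only [pochRatio_add_mul _ hv, Finset.prod_mul_distrib (s := Finset.univ),
    ← Finset.prod_filter]

theorem mem_nextState {b : κ → ℤ_[p]} {v : ℕ} {S : Finset κ} {j : κ} :
    j ∈ nextState b v S ↔ digitZero (b j) < v ∨ j ∈ S ∧ digitZero (b j) = v := by
  simp [nextState]

theorem prod_nextState (b : κ → ℤ_[p]) (v : ℕ) (S : Finset κ) {M : Type*} [CommMonoid M]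
    (f : κ → M) :
    ∏ j ∈ nextState b v S, f j
      = (∏ j with digitZero (b j) < v, f j) * ∏ j ∈ S with digitZero (b j) = v, f j := by
  classical
  have hdisj : Disjoint ({j | digitZero (b j) < v} : Finset κ) {j ∈ S | digitZero (b j) = v} :=
    Finset.disjoint_left.2 fun j hj hj' =>
      (Finset.mem_filter.1 hj).2.ne (Finset.mem_filter.1 hj').2
  rw [← Finset.prod_union hdisj]
  exact Finset.prod_congr (by ext; simp [mem_nextState]) fun _ _ => rfl

theorem natCast_pow_mul_hypCoeff (a : ι → ℤ_[p]) (b : κ → ℤ_[p]) (S : Finset κ) {v : ℕ}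
    (hv : v < p) (z : ℕ) :
    (p : ℚ_[p]) ^ (nextState b v S).card * hypCoeff a b S (v + p * z)
      = (transitionUnit a b S v z : ℤ_[p]) *
        (∏ i with digitZero (a i) < v, p * ((dworkPrime (a i) : ℚ_[p]) + z)) *
          hypCoeff (fun i => dworkPrime (a i)) (fun j => dworkPrime (b j)) (nextState b v S) z := by
  have hp : (p : ℚ_[p]) ^ (nextState b v S).card ≠ 0 :=
    pow_ne_zero _ (Nat.cast_ne_zero.2 (Fact.out : p.Prime).ne_zero)
  have hleft := prod_nextState b v S fun j => p * ((dworkPrime (b j) : ℚ_[p]) + z)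
  rw [Finset.prod_mul_distrib, Finset.prod_const] at hleft
  rw [hypCoeff, hypCoeff, prod_pochRatio_add_mul a hv, prod_pochRatio_add_mul b hv,
    prod_add_natCast_eq b S hv, mul_mul_mul_comm, ← hleft,
    mul_left_comm _ (_ ^ _), ← mul_div_assoc, mul_div_mul_left _ _ hp, transitionUnit,
    Units.val_mul, PadicInt.coe_mul, coe_units_inv]
  simp only [Units.val_mul, Units.coe_prod, PadicInt.coe_mul, coe_prod]
  ring

theorem isLip_natCast_mul_add (x : ℤ_[p]) : IsLip p 1 fun z : ℕ => (p : ℤ_[p]) * (x + z) := by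
  simpa using ((IsLip.const p 0 x).add isLip_natCast).pow_mul 1

theorem exists_hypCoeff_transition (a : ι → ℤ_[p]) (b : κ → ℤ_[p]) (S : Finset κ) {v : ℕ}
    (hv : v < p) (h : (nextState b v S).Nonempty →
      (nextState b v S).card < Finset.card {i | digitZero (a i) < v}) :
    ∃ V : ℕ → ℤ_[p],
      (∀ z, hypCoeff a b S (v + p * z) = V z *
        hypCoeff (fun i => dworkPrime (a i)) (fun j => dworkPrime (b j)) (nextState b v S) z) ∧
      IsLip p 1 V ∧
      (nextState b v S = ∅ ∨ ∃ V' : ℕ → ℤ_[p], IsLip p 0 V' ∧ ∀ z, V z = p * V' z) := by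
  have hp : (p : ℚ_[p]) ≠ 0 := Nat.cast_ne_zero.2 (Fact.out : p.Prime).ne_zero
  have hU := isLip_transitionUnit a b S v
  have hrel := natCast_pow_mul_hypCoeff a b S hv
  set U := transitionUnit a b S v
  set A : Finset ι := {i | digitZero (a i) < v}
  rcases (nextState b v S).eq_empty_or_nonempty with hS | hS
  · refine ⟨fun z => U z * ∏ i ∈ A, p * (dworkPrime (a i) + z), fun z => ?_,
      hU.mul (IsLip.prod _ fun i _ => isLip_natCast_mul_add _), Or.inl hS⟩
    simpa [hS, coe_prod] using hrel z
  · obtain ⟨d, hd⟩ := Nat.exists_eq_add_of_lt (h hS)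
    set V' : ℕ → ℤ_[p] := fun z => U z * (p ^ d * ∏ i ∈ A, (dworkPrime (a i) + z))
    have hprod : IsLip p 0 fun z => ∏ i ∈ A, (dworkPrime (a i) + (z : ℤ_[p])) :=
      IsLip.prod _ fun i _ => (IsLip.const p 0 _).add isLip_natCast
    have hV' : IsLip p 0 V' := (hU.mono zero_le_one).mul ((hprod.pow_mul d).mono (Nat.zero_le _))
    refine ⟨fun z => p * V' z, fun z => mul_left_cancel₀ (pow_ne_zero _ hp) ((hrel z).trans ?_),
      by simpa using hV'.pow_mul 1, Or.inr ⟨V', hV', fun _ => rfl⟩⟩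
    simp only [V', Finset.prod_mul_distrib, Finset.prod_const, hd, PadicInt.coe_mul, coe_prod,
      PadicInt.coe_add, PadicInt.coe_natCast, PadicInt.coe_pow]
    ring

end Transition

section Coefficients

variable {r : ℕ} {a : Fin (r + 1) → ℤ_[p]} {b : Fin r → ℤ_[p]}

/-- Conditions (i) and (ii) on the parameters: the Dwork primes of the `b_j ≠ 1` are units, and
the digits of the `a_i` and `b_j` interlace. -/
structure DigitConditions (a : Fin (r + 1) → ℤ_[p]) (b : Fin r → ℤ_[p]) : Prop where
  norm_b : ∀ j, b j ≠ 1 → ∀ i, ‖dworkIter i (b j)‖ = 1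
  digits : ∀ n : ℕ, ∀ (ρ : Equiv.Perm (Fin (r + 1))) (τ : Equiv.Perm (Fin r)),
    Monotone (fun i => digit n (a (ρ i))) → Monotone (fun j => digit n (b (τ j))) →
    ∀ j : Fin r, (j : ℕ) < Nat.card {k : Fin r // b k ≠ 1} →
      digit n (a (ρ j.succ)) < digit n (b (τ j))

/-- The sets `S` of denominators that can occur: since the last digit of `1` is `p - 1`, no
denominator is ever left behind by a parameter `b_j = 1`. -/
abbrev State (b : Fin r → ℤ_[p]) : Type := {S : Finset (Fin r) // ∀ j ∈ S, b j ≠ 1}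

/-- The state without denominators. -/
def State.empty (b : Fin r → ℤ_[p]) : State b := ⟨∅, by simp⟩

theorem ne_one_of_mem_nextState {n v : ℕ} (hv : v < p) (S : State b) {j : Fin r}
    (hj : j ∈ nextState (fun j => dworkIter n (b j)) v S) : b j ≠ 1 := by
  rcases mem_nextState.1 hj with h | h
  · rintro h1
    simp only [h1, dworkIter_one, digitZero_one] at h
    lia
  · exact S.2 j h.1

/-- The coefficients `hypCoeff` of the series `F^{(n)}`. -/
def stateCoeff (a : Fin (r + 1) → ℤ_[p]) (b : Fin r → ℤ_[p]) (n : ℕ) (S : State b) (z : ℕ) :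
    ℚ_[p] :=
  hypCoeff (fun i => dworkIter n (a i)) (fun j => dworkIter n (b j)) S z

namespace DigitConditions

variable (hab : DigitConditions a b)
include hab

theorem exists_transition (n : ℕ) (S : State b) {v : ℕ} (hv : v < p) :
    ∃ (S' : State b) (V : ℕ → ℤ_[p]),
      (∀ z, stateCoeff a b n S (v + p * z) = V z * stateCoeff a b (n + 1) S' z) ∧ IsLip p 1 V ∧
      (S' = State.empty b ∨ ∃ V' : ℕ → ℤ_[p], IsLip p 0 V' ∧ ∀ z, V z = p * V' z) := by
  have hne := fun j => ne_one_of_mem_nextState (n := n) (j := j) hv S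
  obtain ⟨V, hV, hLip, hnext⟩ := exists_hypCoeff_transition (fun i => dworkIter n (a i)) _ S hv
    fun hS => card_lt_card_of_interlacing (hab.digits n) hS hne fun j hj =>
      (mem_nextState.1 hj).elim le_of_lt fun h => h.2.le
  refine ⟨⟨_, hne⟩, V, fun z => ?_, hLip, hnext.imp_left Subtype.ext⟩
  simp only [stateCoeff, hV, dworkIter_succ]

theorem norm_stateCoeff_zero (n : ℕ) (S : State b) : ‖stateCoeff a b n S 0‖ = 1 := by
  have hnorm : ∏ j ∈ S.1, ‖dworkIter n (b j)‖ = 1 :=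
    Finset.prod_eq_one fun j hj => hab.norm_b j (S.2 j hj) n
  simpa [stateCoeff, hypCoeff, pochRatio, poch, norm_prod] using hnorm

theorem norm_stateCoeff_le (n : ℕ) (S : State b) (z : ℕ) : ‖stateCoeff a b n S z‖ ≤ 1 := by
  induction z using Nat.strong_induction_on generalizing n S with
  | _ z ih =>
    have hp : p.Prime := Fact.out
    rcases z.eq_zero_or_pos with rfl | hz
    · exact (hab.norm_stateCoeff_zero n S).le
    · obtain ⟨S', V, hV, -⟩ := hab.exists_transition n S (Nat.mod_lt z hp.pos)
      rw [← Nat.mod_add_div z p, hV, norm_mul]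
      exact mul_le_one₀ (V _).2 (norm_nonneg _) (ih _ (Nat.div_lt_self hz hp.one_lt) (n + 1) S')

/-- The `p`-adic integers `stateCoeff a b n S z`. -/
def intCoeff (n : ℕ) (S : State b) (z : ℕ) : ℤ_[p] :=
  ⟨stateCoeff a b n S z, hab.norm_stateCoeff_le n S z⟩

theorem coe_intCoeff (n : ℕ) (S : State b) (z : ℕ) :
    (hab.intCoeff n S z : ℚ_[p]) = stateCoeff a b n S z := rfl

theorem isDworkSystem_intCoeff : IsDworkSystem p (State.empty b) hab.intCoeff := by
  intro n S v hv
  obtain ⟨S', V, hV, hLip, hnext⟩ := hab.exists_transition n S hv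
  exact ⟨S', V, fun z => PadicInt.ext (by simpa [coe_intCoeff] using hV z), hLip, hnext⟩

theorem intCoeff_zero (n : ℕ) : hab.intCoeff n (State.empty b) 0 = 1 :=
  PadicInt.ext (by simp [coe_intCoeff, stateCoeff, hypCoeff, pochRatio, poch, State.empty])

theorem hypSeries_eq_mk_intCoeff (n : ℕ) :
    hypSeries (fun i => dworkIter n (a i)) (fun j => dworkIter n (b j))
      = PowerSeries.mk fun z => (hab.intCoeff n (State.empty b) z : ℚ_[p]) := by
  ext z
  have hz : poch (1 : ℤ_[p]) z ≠ 0 := Finset.prod_ne_zero_iff.2 fun k _ => by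
    rw [PadicInt.coe_one, add_comm]; exact Nat.cast_add_one_ne_zero k
  simp only [hypSeries, PowerSeries.coeff_mk, coe_intCoeff, stateCoeff, State.empty, hypCoeff,
    pochRatio, Finset.prod_empty, mul_one, Finset.prod_div_distrib, Finset.prod_const,
    Finset.card_univ, Fintype.card_fin]
  field_simp
  ring

theorem intCoeff_natCast_mul (n z : ℕ) :
    hab.intCoeff n (State.empty b) (p * z)
      = ((∏ i, unitRatio (dworkIter n (a i)) (p * z)) *
        (∏ j, unitRatio (dworkIter n (b j)) (p * z))⁻¹ : ℤ_[p]ˣ) *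
          hab.intCoeff (n + 1) (State.empty b) z := by
  have hnext : nextState (fun j => dworkIter n (b j)) 0 ∅ = ∅ := by ext j; simp [mem_nextState]
  have hrel := natCast_pow_mul_hypCoeff (fun i => dworkIter n (a i)) (fun j => dworkIter n (b j)) ∅
    (Fact.out : p.Prime).pos z
  simp only [hnext, Finset.card_empty, pow_zero, one_mul, zero_add, not_lt_zero,
    Finset.filter_false, Finset.prod_empty, mul_one, transitionUnit, ← dworkIter_succ] at hrel
  exact PadicInt.ext (by simpa [coe_intCoeff, stateCoeff, State.empty] using hrel)

end DigitConditions

end Coefficients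

end

/-! ### The series `G` as a weighted form of `F` -/

noncomputable section

section LogWeight

variable {Q : Type*} [CommRing Q] {p : ℕ} {Φ : ℕ → Q}

open Classical in
/-- The ratio of the `k`-th coefficients of `G` and `F`, where `Φ` measures the failure of
`F^{(1)}(c t^p)` to agree with the part of `F` in degrees divisible by `p`. -/
def logWeight (p : ℕ) (Φ : ℕ → Q) (k : ℕ) : Q :=
  if p ∣ k then -Φ (k / p) else Ring.inverse (k : Q)

theorem isLip_natCast_mul_logWeight (hp : 0 < p) (hunit : ∀ n : ℕ, ¬ p ∣ n → IsUnit (n : Q))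
    (hΦ : IsLip p 0 Φ) : IsLip p 0 fun k => p * logWeight p Φ k := by
  rintro (_ | k) z z' h
  · simp
  have hdvd : p ∣ z ↔ p ∣ z' := (h.of_dvd (dvd_pow_self p k.succ_ne_zero)).dvd_iff dvd_rfl
  by_cases hz : p ∣ z
  · obtain ⟨⟨l, rfl⟩, l', rfl⟩ := And.intro hz (hdvd.1 hz)
    have hl : l ≡ l' [MOD p ^ k] := Nat.ModEq.mul_left_cancel' hp.ne' (pow_succ' p k ▸ h)
    simp only [logWeight, dvd_mul_right, if_true, Nat.mul_div_cancel_left _ hp, ← mul_sub, add_zero,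
      pow_succ']
    exact mul_dvd_mul_left _ (hΦ.neg hl)
  · have hinv := Ring.mul_inverse_cancel _ (hunit z hz)
    have hinv' := Ring.mul_inverse_cancel _ (hunit z' (mt hdvd.2 hz))
    have hsub : Ring.inverse (z : Q) - Ring.inverse (z' : Q)
        = ((z : Q) - z') * -(Ring.inverse (z : Q) * Ring.inverse (z' : Q)) := by
      linear_combination Ring.inverse (z' : Q) * hinv - Ring.inverse (z : Q) * hinv'
    simp only [logWeight, hz, mt hdvd.2 hz, if_false, ← mul_sub]
    rw [hsub]
    exact ((isLip_natCast h).mul_right _).mul_left _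

theorem natCast_mul_logWeight_mul (hp : 0 < p) (hunit : ∀ n : ℕ, ¬ p ∣ n → IsUnit (n : Q))
    {A A' : ℕ → Q} {c : Q} (h : ∀ l : ℕ, c ^ l * A' l = (1 + p * l * Φ l) * A (p * l)) (k : ℕ) :
    k * (logWeight p Φ k * A k) = A k - if p ∣ k then c ^ (k / p) * A' (k / p) else 0 := by
  by_cases hk : p ∣ k
  · obtain ⟨l, rfl⟩ := hk
    simp only [logWeight, dvd_mul_right, if_true, Nat.mul_div_cancel_left _ hp, h]
    push_cast
    ring
  · simp only [logWeight, hk, if_false, sub_zero, ← mul_assoc,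
      Ring.mul_inverse_cancel _ (hunit k hk), one_mul]

end LogWeight

variable {p : ℕ} [Fact p.Prime]

theorem exists_hasLogDeriv_prod_unitRatio {ι : Type*} [Fintype ι] (α : ι → ℤ_[p]) :
    ∃ y : ℤ_[p], HasLogDeriv p (fun l => ((∏ i, unitRatio (α i) (p * l) : ℤ_[p]ˣ) : ℤ_[p])) y ∧
      ∑ i, psiTilde (α i) = y := by
  choose y hy hψ using fun i => exists_hasLogDeriv_unitRatio (α i)
  refine ⟨∑ i, y i, by simpa only [Units.coe_prod] using HasLogDeriv.prod _ fun i _ => hy i, ?_⟩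
  simp only [hψ]
  exact (map_sum PadicInt.Coe.ringHom y Finset.univ).symm

variable {r : ℕ} {a : Fin (r + 1) → ℤ_[p]} {b : Fin r → ℤ_[p]}

theorem sum_psi_sub_sum_psi_add_eulerConst (a : Fin (r + 1) → ℤ_[p]) (b : Fin r → ℤ_[p]) :
    ∑ i, psi (a i) - ∑ j, psi (b j) + eulerConst p
      = ∑ i, psiTilde (a i) - ∑ j, psiTilde (b j) := by
  simp only [psi, Finset.sum_add_distrib, Finset.sum_const, Finset.card_univ, Fintype.card_fin,
    nsmul_eq_mul]
  push_cast
  ring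

theorem coeff_zero_hypG (a : Fin (r + 1) → ℤ_[p]) (b : Fin r → ℤ_[p]) (c : W p) :
    PowerSeries.coeff 0 (hypG a b c)
      = qpToK p (∑ i, psiTilde (a i) - ∑ j, psiTilde (b j))
        - (p : K p)⁻¹ * logK p (algebraMap (W p) (K p) c) := by
  rw [hypG, (PowerSeries.coeff 0).map_add, PowerSeries.coeff_zero_C, integ, PowerSeries.coeff_mk,
    Nat.cast_zero, div_zero, add_zero, sum_psi_sub_sum_psi_add_eulerConst]

theorem natCast_mul_coeff_hypG {k : ℕ} (hk : k ≠ 0) (a : Fin (r + 1) → ℤ_[p])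
    (b : Fin r → ℤ_[p]) (c : W p) :
    k * PowerSeries.coeff k (hypG a b c) = PowerSeries.coeff k (hypF a b 0)
      - if p ∣ k then algebraMap (W p) (K p) c ^ (k / p) * PowerSeries.coeff (k / p) (hypF a b 1)
        else 0 := by
  rw [hypG, (PowerSeries.coeff k).map_add, PowerSeries.coeff_C, if_neg hk, zero_add, integ,
    PowerSeries.coeff_mk, map_sub, substSigma, PowerSeries.coeff_mk,
    mul_div_cancel₀ _ (natCast_K_ne_zero p hk)]

namespace DigitConditions

variable (hab : DigitConditions a b)
include hab

/-- The `p`-adic integers `intCoeff` as elements of `W`. -/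
def wittCoeff (n : ℕ) (S : State b) (z : ℕ) : W p := zpToW p (hab.intCoeff n S z)

theorem isDworkSystem_wittCoeff : IsDworkSystem p (State.empty b) hab.wittCoeff :=
  hab.isDworkSystem_intCoeff.map (zpToW p)

/-- The series `F^{(n)}` over `W`. -/
def wittF (n : ℕ) : PowerSeries (W p) := PowerSeries.mk (hab.wittCoeff n (State.empty b))

theorem map_wittF (n : ℕ) :
    PowerSeries.map (algebraMap (W p) (K p)) (hab.wittF n) = hypF a b n := by
  ext z
  simp only [hypF, hab.hypSeries_eq_mk_intCoeff, wittF, PowerSeries.coeff_map,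
    PowerSeries.coeff_mk, wittCoeff, qpToK_coe]

theorem wittCoeff_zero (n : ℕ) : hab.wittCoeff n (State.empty b) 0 = 1 := by
  rw [wittCoeff, intCoeff_zero, map_one]

theorem exists_hasLogDeriv_ratio :
    ∃ (u : ℕ → ℤ_[p]ˣ) (y : ℤ_[p]), HasLogDeriv p (fun l => (u l : ℤ_[p])) y ∧
      ∑ i, psiTilde (a i) - ∑ j, psiTilde (b j) = y ∧
      ∀ l, hab.intCoeff 0 (State.empty b) (p * l) = u l * hab.intCoeff 1 (State.empty b) l := by
  obtain ⟨y, hy, hψa⟩ := exists_hasLogDeriv_prod_unitRatio a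
  obtain ⟨x, hx, hψb⟩ := exists_hasLogDeriv_prod_unitRatio b
  exact ⟨fun l => (∏ i, unitRatio (a i) (p * l)) * (∏ j, unitRatio (b j) (p * l))⁻¹, y - x,
    by simpa only [Units.val_mul, sub_eq_add_neg] using hy.mul hx.inv,
    by rw [hψa, hψb, PadicInt.coe_sub], hab.intCoeff_natCast_mul 0⟩

theorem exists_map_eq_hypG (w : W p) :
    ∃ q : ℕ → W p, IsLip p 0 (fun k => p * q k) ∧
      PowerSeries.map (algebraMap (W p) (K p))
        (PowerSeries.mk fun k => q k * hab.wittCoeff 0 (State.empty b) k)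
        = hypG a b (1 + p * w) := by
  have hp : p.Prime := Fact.out
  obtain ⟨ℓ, hℓ, hlog⟩ := exists_hasLogDeriv_and_eq_logK w
  obtain ⟨u, y, hy, hψ, hu⟩ := hab.exists_hasLogDeriv_ratio
  obtain ⟨Φ, hΦ, hΦLip, hΦ₀⟩ := hℓ.mul (hy.inv.map (zpToW p))
  have hA (l : ℕ) : (1 + p * w) ^ l * hab.wittCoeff 1 (State.empty b) l
      = (1 + p * l * Φ l) * hab.wittCoeff 0 (State.empty b) (p * l) := by
    have hul : zpToW p ((u l)⁻¹ : ℤ_[p]ˣ) * zpToW p (u l) = 1 := by rw [← map_mul]; simp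
    rw [← hΦ, wittCoeff, wittCoeff, hu, map_mul]
    linear_combination (-(1 + p * w) ^ l * zpToW p (hab.intCoeff 1 (State.empty b) l)) * hul
  refine ⟨logWeight p Φ,
    isLip_natCast_mul_logWeight hp.pos (fun _ => isUnit_natCast_of_not_dvd hp) hΦLip, ?_⟩
  ext k
  rw [PowerSeries.coeff_map, PowerSeries.coeff_mk]
  rcases eq_or_ne k 0 with rfl | hk
  · have hp₀ : (p : K p) ≠ 0 := natCast_K_ne_zero p hp.ne_zero
    rw [coeff_zero_hypG, hψ, qpToK_coe, ← hlog, hab.wittCoeff_zero, mul_one, logWeight,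
      if_pos (dvd_zero p), Nat.zero_div, hΦ₀]
    simp only [map_neg, map_add, map_mul, map_natCast]
    field_simp
    ring
  · refine mul_left_cancel₀ (natCast_K_ne_zero p hk) ?_
    have hk' := congrArg (algebraMap (W p) (K p))
      (natCast_mul_logWeight_mul hp.pos (fun _ => isUnit_natCast_of_not_dvd hp) hA k)
    rw [natCast_mul_coeff_hypG hk, ← hab.map_wittF, ← hab.map_wittF]
    simp only [wittF, PowerSeries.coeff_map, PowerSeries.coeff_mk]
    rw [map_mul, map_natCast, map_sub, apply_ite (algebraMap (W p) (K p))] at hk'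
    simpa only [map_mul, map_pow, map_zero] using hk'

end DigitConditions

end

/-! ### The Tate algebra -/

section TateAlgebra

variable {p : ℕ} [Fact p.Prime] {h : (W p)[X]} {B : Type*} [CommRing B]

theorem toSeries_algebraMap (hu : IsUnit (h : PowerSeries (W p))) (g : (W p)[X]) :
    toSeries h hu (algebraMap _ (LocRing h) g) = (g : PowerSeries (W p)) :=
  IsLocalization.Away.lift_eq h hu g

theorem evalAt_algebraMap {α : W p} (hα : IsUnit (h.eval α)) (g : (W p)[X]) :
    evalAt h α hα (algebraMap _ (LocRing h) g) = g.eval α :=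
  IsLocalization.Away.lift_eq h hα g

theorem natCast_pow_dvd_powerSeries_iff {R : Type*} [CommRing R] {p n : ℕ} {f : PowerSeries R} :
    (p : PowerSeries R) ^ n ∣ f ↔ ∀ k, (p : R) ^ n ∣ PowerSeries.coeff k f := by
  rw [← map_natCast PowerSeries.C, ← map_pow]
  refine ⟨?_, fun hf => ?_⟩
  · rintro ⟨g, rfl⟩ k
    exact PowerSeries.coeff_C_mul k g _ ▸ dvd_mul_right _ _
  · choose g hg using hf
    exact ⟨PowerSeries.mk g, by ext k; rw [PowerSeries.coeff_C_mul, PowerSeries.coeff_mk, hg]⟩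

theorem pow_dvd_of_pow_dvd_toSeries (hu : IsUnit (h : PowerSeries (W p))) {n : ℕ} {y : LocRing h}
    (hy : (p : PowerSeries (W p)) ^ n ∣ toSeries h hu y) : (p : LocRing h) ^ n ∣ y := by
  obtain ⟨k, g, hg⟩ := IsLocalization.Away.surj h y
  have hg_series : (p : PowerSeries (W p)) ^ n ∣ (g : PowerSeries (W p)) := by
    rw [← toSeries_algebraMap hu, ← hg, map_mul]
    exact hy.mul_right _
  have hg_dvd : (p : (W p)[X]) ^ n ∣ g := by
    simpa only [natCast_pow_dvd_powerSeries_iff, natCast_pow_dvd_polynomial_iff,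
      Polynomial.coeff_coe] using hg_series
  have hunit : IsUnit (algebraMap (W p)[X] (LocRing h) h ^ k) :=
    (IsLocalization.Away.algebraMap_isUnit h).pow k
  have hdvd := map_dvd (algebraMap (W p)[X] (LocRing h)) hg_dvd
  rwa [← hg, map_pow, map_natCast, hunit.dvd_mul_right] at hdvd

theorem isImage_mk_iff (φ : LocRing h →+* B) {X : B}
    (s : AdicCompletion.AdicCauchySequence (Ideal.span {(p : LocRing h)}) (LocRing h)) :
    IsImage φ (AdicCompletion.mk _ _ s) X ↔ ∀ n, (p : B) ^ n ∣ φ (s n) - X := by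
  refine forall_congr' fun n => ?_
  rw [AdicCompletion.evalₐ_mk, Ideal.quotientMap_mk, Ideal.Quotient.mk_eq_mk_iff_sub_mem,
    Ideal.span_singleton_pow, Ideal.mem_span_singleton]

theorem exists_isImage_iff_eq [IsAdicComplete (Ideal.span {(p : B)}) B] (φ : LocRing h →+* B)
    (f : TateAlg h) : ∃ v, ∀ v', IsImage φ f v' ↔ v' = v := by
  obtain ⟨s, rfl⟩ := AdicCompletion.mk_surjective _ _ f
  obtain ⟨v, hv⟩ := IsPrecomplete.prec (I := Ideal.span {(p : B)}) (f := fun n => φ (s n))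
    inferInstance fun {m n} hmn => by
      have hs := map_dvd φ (smodEq_span_pow_iff.1 (s.2 hmn))
      rwa [map_pow, map_natCast, map_sub, ← smodEq_span_pow_iff] at hs
  simp only [smodEq_span_pow_iff] at hv
  refine ⟨v, fun v' => (isImage_mk_iff φ s).trans ⟨fun hv' => ?_, fun h => h ▸ hv⟩⟩
  refine eq_of_forall_pow_dvd_sub (p := p) fun n => ?_
  rw [← sub_sub_sub_cancel_left _ _ (φ (s n))]
  exact dvd_sub (hv n) (hv' n)

theorem eq_of_isImage_toSeries (hu : IsUnit (h : PowerSeries (W p))) {f f' : TateAlg h}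
    {𝓕 : PowerSeries (W p)} (hf : IsImage (toSeries h hu) f 𝓕)
    (hf' : IsImage (toSeries h hu) f' 𝓕) : f = f' := by
  obtain ⟨s, rfl⟩ := AdicCompletion.mk_surjective _ _ f
  obtain ⟨s', rfl⟩ := AdicCompletion.mk_surjective _ _ f'
  rw [isImage_mk_iff] at hf hf'
  refine AdicCompletion.ext_evalₐ fun n => ?_
  rw [AdicCompletion.evalₐ_mk, AdicCompletion.evalₐ_mk, Ideal.Quotient.mk_eq_mk_iff_sub_mem,
    Ideal.span_singleton_pow, Ideal.mem_span_singleton]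
  refine pow_dvd_of_pow_dvd_toSeries hu ?_
  rw [map_sub, ← sub_sub_sub_cancel_right _ _ 𝓕]
  exact dvd_sub (hf n) (hf' n)

theorem exists_isImage_toSeries_iff_eq (hu : IsUnit (h : PowerSeries (W p)))
    {𝓕 : PowerSeries (W p)}
    (h𝓕 : ∀ n, ∃ x, (p : PowerSeries (W p)) ^ n ∣ toSeries h hu x - 𝓕) :
    ∃ f : TateAlg h, ∀ f', IsImage (toSeries h hu) f' 𝓕 ↔ f' = f := by
  choose x hx using h𝓕
  let s := AdicCompletion.AdicCauchySequence.mk (Ideal.span {(p : LocRing h)}) (LocRing h) x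
    fun n => smodEq_span_pow_iff.2 <| pow_dvd_of_pow_dvd_toSeries hu <| by
      rw [map_sub, ← sub_sub_sub_cancel_right _ _ 𝓕]
      exact dvd_sub (hx n) ((pow_dvd_pow _ n.le_succ).trans (hx (n + 1)))
  have hs : IsImage (toSeries h hu) (AdicCompletion.mk _ _ s) 𝓕 := (isImage_mk_iff _ s).2 hx
  exact ⟨_, fun f' => ⟨fun hf' => eq_of_isImage_toSeries hu hf' hs, fun hf' => hf' ▸ hs⟩⟩

theorem exists_pow_dvd_toSeries_sub (hu : IsUnit (h : PowerSeries (W p))) {𝓕 : PowerSeries (W p)}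
    {F G : (W p)[X]} {n : ℕ} (hF : IsCoprime (algebraMap _ (LocRing h) F) p)
    (hFG : (p : PowerSeries (W p)) ^ n ∣ G - 𝓕 * F) :
    ∃ x, (p : PowerSeries (W p)) ^ n ∣ toSeries h hu x - 𝓕 := by
  obtain ⟨y, z, hyz⟩ := hF.pow_right (n := n)
  refine ⟨y * algebraMap _ _ G, ?_⟩
  have hyz' := congrArg (toSeries h hu) hyz
  simp only [map_add, map_mul, map_pow, map_natCast, map_one, toSeries_algebraMap] at hyz' ⊢
  rw [show toSeries h hu y * G - 𝓕
      = (G - 𝓕 * F) * toSeries h hu y - p ^ n * (𝓕 * toSeries h hu z) by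
    linear_combination 𝓕 * hyz']
  exact dvd_sub (hFG.mul_right _) (dvd_mul_right _ _)

/-- Congruences between expansions persist under the `p`-adic continuation of `φ`. -/
theorem IsImage.pow_dvd_sub_mul {hu : IsUnit (h : PowerSeries (W p))} {f : TateAlg h}
    {𝓕 : PowerSeries (W p)} (hf : IsImage (toSeries h hu) f 𝓕) {φ : LocRing h →+* B} {v : B}
    (hv : IsImage φ f v) {F G : (W p)[X]} {n : ℕ}
    (hFG : (p : PowerSeries (W p)) ^ n ∣ G - 𝓕 * F) :
    (p : B) ^ n ∣ φ (algebraMap _ _ G) - v * φ (algebraMap _ _ F) := by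
  obtain ⟨s, rfl⟩ := AdicCompletion.mk_surjective _ _ f
  rw [isImage_mk_iff] at hf hv
  have hs : (p : LocRing h) ^ n ∣ algebraMap _ _ G - s n * algebraMap _ _ F := by
    refine pow_dvd_of_pow_dvd_toSeries hu ?_
    simp only [map_sub, map_mul, toSeries_algebraMap]
    rw [show G - toSeries h hu (s n) * F
      = (G - 𝓕 * F : PowerSeries (W p)) - (toSeries h hu (s n) - 𝓕) * F by ring]
    exact dvd_sub hFG ((hf n).mul_right _)
  have hφ := map_dvd φ hs
  rw [map_pow, map_natCast, map_sub, map_mul] at hφ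
  rw [show φ (algebraMap _ _ G) - v * φ (algebraMap _ _ F)
    = φ (algebraMap _ _ G) - φ (s n) * φ (algebraMap _ _ F)
      + (φ (s n) - v) * φ (algebraMap _ _ F) by ring]
  exact dvd_add hφ ((hv n).mul_right _)

theorem isUnit_of_isCoprime_natCast {x : W p} (hx : IsCoprime x p) : IsUnit x := by
  obtain ⟨y, z, hyz⟩ := hx
  have hp : ¬ IsUnit (z * (p : W p)) := fun hz =>
    (WittVector.irreducible p).not_isUnit (isUnit_of_mul_isUnit_right hz)
  exact isUnit_of_mul_isUnit_right ((IsLocalRing.isUnit_or_isUnit_of_add_one hyz).resolve_right hp)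

end TateAlgebra

section Truncations

variable {p : ℕ} [Fact p.Prime]

theorem exists_le_eq_of_finite_range {X : Type*} {f : ℕ → X} (hf : (Set.range f).Finite) :
    ∃ N, ∀ i, ∃ k ≤ N, f k = f i := by
  obtain ⟨t, -, ht, htf⟩ := hf.exists_subset_finite_image_eq Set.image_univ.ge
  obtain ⟨N, hN⟩ := ht.bddAbove
  refine ⟨N, fun i => ?_⟩
  obtain ⟨k, hk, hki⟩ := htf.ge (Set.mem_range_self i)
  exact ⟨k, hN hk, hki⟩

theorem natCast_dvd_sub_of_map_toZMod_eq {f g : ℤ_[p][X]}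
    (hfg : f.map PadicInt.toZMod = g.map PadicInt.toZMod) : (p : ℤ_[p][X]) ∣ f - g := by
  rw [← pow_one (p : ℤ_[p][X]), natCast_pow_dvd_polynomial_iff]
  intro k
  have hk := congrArg (Polynomial.coeff · k) hfg
  simp only [Polynomial.coeff_map] at hk
  rw [pow_one, ← Ideal.mem_span_singleton, ← PadicInt.maximalIdeal_eq_span_p,
    ← PadicInt.ker_toZMod, RingHom.mem_ker, Polynomial.coeff_sub, map_sub, hk, sub_self]

theorem finite_range_trunc {F : Type*} [Field F] [Finite F] (n : ℕ) (f : ℕ → PowerSeries F) :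
    (Set.range fun i => PowerSeries.trunc n (f i)).Finite := by
  have : Finite (Polynomial.degreeLT F n) :=
    Finite.of_equiv _ (Polynomial.degreeLTEquiv F n).symm.toEquiv
  refine (Set.toFinite (Polynomial.degreeLT F n : Set F[X])).subset ?_
  rintro _ ⟨i, rfl⟩
  exact Polynomial.mem_degreeLT.2 (PowerSeries.degree_trunc_lt _ _)

theorem eval_trunc_map (f : PowerSeries (W p)) (n : ℕ) (α : W p) :
    (PowerSeries.trunc n (PowerSeries.map (algebraMap (W p) (K p)) f)).eval
      (algebraMap (W p) (K p) α) = algebraMap (W p) (K p) ((PowerSeries.trunc n f).eval α) := by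
  rw [PowerSeries.trunc_map, Polynomial.eval_map, Polynomial.eval₂_at_apply]

theorem isPadicLimit_div {f g : ℕ → W p} {v : W p} (hf : ∀ n, IsUnit (f n))
    (h : ∀ n, (p : W p) ^ n ∣ g (n + 1) - v * f (n + 1)) :
    IsPadicLimit p (fun n => algebraMap (W p) (K p) (g n) / algebraMap (W p) (K p) (f n))
      (algebraMap (W p) (K p) v) := by
  choose u hu using hf
  have hdiv (n : ℕ) : algebraMap (W p) (K p) (g n) / algebraMap (W p) (K p) (f n)
      = algebraMap (W p) (K p) (g n * (u n)⁻¹.val) := by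
    have hf₀ : algebraMap (W p) (K p) (f n) ≠ 0 := by
      simpa only [← hu] using ((u n).isUnit.map (algebraMap (W p) (K p))).ne_zero
    rw [div_eq_iff hf₀, ← map_mul, ← hu, mul_assoc, Units.inv_mul, mul_one]
  simp only [hdiv]
  refine isPadicLimit_of_dvd fun n => (eventually_ge_atTop (n + 1)).mono fun m hm => ?_
  obtain ⟨k, rfl⟩ := Nat.exists_eq_add_of_le' (Nat.le_of_add_left_le hm)
  rw [← (u (k + 1)).isUnit.dvd_mul_right, sub_mul, mul_assoc, Units.inv_mul, mul_one, hu]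
  exact (pow_dvd_pow _ (Nat.le_of_succ_le_succ hm)).trans (h k)

end Truncations

namespace DigitConditions

variable {p : ℕ} [Fact p.Prime] {r : ℕ} {a : Fin (r + 1) → ℤ_[p]} {b : Fin r → ℤ_[p]}
  (hab : DigitConditions a b)
include hab

/-- The polynomial `h = ∏_{i ≤ N} [F^{(i)}]_{<p}` over `W`. -/
noncomputable def wittPoly (N : ℕ) : (W p)[X] :=
  ∏ i ∈ Finset.range (N + 1), PowerSeries.trunc p (hab.wittF i)

theorem map_wittPoly (N : ℕ) :
    (hab.wittPoly N).map (algebraMap (W p) (K p)) = hypPoly a b N := by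
  simp only [wittPoly, hypPoly, Polynomial.map_prod, ← PowerSeries.trunc_map, map_wittF]

theorem constantCoeff_wittF (n : ℕ) : PowerSeries.constantCoeff (hab.wittF n) = 1 := by
  rw [← PowerSeries.coeff_zero_eq_constantCoeff_apply, wittF, PowerSeries.coeff_mk,
    hab.wittCoeff_zero]

theorem isUnit_wittPoly (N : ℕ) : IsUnit (hab.wittPoly N : PowerSeries (W p)) := by
  have hp : 0 < p := (Fact.out : p.Prime).pos
  have hcoeff (i : ℕ) : (PowerSeries.trunc p (hab.wittF i)).coeff 0 = 1 := by
    rw [PowerSeries.coeff_trunc, if_pos hp, PowerSeries.coeff_zero_eq_constantCoeff_apply,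
      hab.constantCoeff_wittF]
  rw [PowerSeries.isUnit_iff_constantCoeff, Polynomial.constantCoeff_coe, wittPoly,
    Polynomial.coeff_zero_prod]
  simp only [hcoeff, Finset.prod_const_one, isUnit_one]

theorem exists_trunc_wittF_modEq : ∃ N₀, ∀ m, ∃ κ : ℕ → ℕ, (∀ k, κ k ≤ N₀) ∧
    (p : (W p)[X]) ∣ PowerSeries.trunc (p ^ m) (hab.wittF 0)
      - ∏ k ∈ Finset.range m, PowerSeries.trunc p (hab.wittF (κ k)) ^ p ^ k := by
  let F : ℕ → PowerSeries ℤ_[p] := fun i => .mk (hab.intCoeff i (State.empty b))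
  have hF (i : ℕ) : hab.wittF i = PowerSeries.map (zpToW p) (F i) := by
    ext z; simp only [F, wittF, wittCoeff, PowerSeries.coeff_mk, PowerSeries.coeff_map]
  obtain ⟨N₀, hN₀⟩ := exists_le_eq_of_finite_range
    (finite_range_trunc p fun i => PowerSeries.map PadicInt.toZMod (F i))
  choose κ hκ hres using hN₀
  refine ⟨N₀, fun m => ⟨κ, hκ, ?_⟩⟩
  have hdvd : (p : ℤ_[p][X]) ∣ PowerSeries.trunc (p ^ m) (F 0)
      - ∏ k ∈ Finset.range m, PowerSeries.trunc p (F (κ k)) ^ p ^ k := by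
    refine natCast_dvd_sub_of_map_toZMod_eq ?_
    rw [hab.isDworkSystem_intCoeff.map_trunc_pow hab.intCoeff_zero, Polynomial.map_prod]
    refine Finset.prod_congr rfl fun k _ => ?_
    rw [Polynomial.map_pow, ← PowerSeries.trunc_map, ← PowerSeries.trunc_map, hres, zero_add]
  simpa only [map_natCast, map_sub, map_prod, map_pow, Polynomial.coe_mapRingHom,
    ← PowerSeries.trunc_map, ← hF] using map_dvd (Polynomial.mapRingHom (zpToW p)) hdvd

theorem exists_isCoprime_trunc_wittF : ∃ N₀, ∀ N ≥ N₀, ∀ m,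
    IsCoprime (algebraMap _ (LocRing (hab.wittPoly N)) (PowerSeries.trunc (p ^ m) (hab.wittF 0)))
      p := by
  obtain ⟨N₀, hN₀⟩ := hab.exists_trunc_wittF_modEq
  refine ⟨N₀, fun N hN m => ?_⟩
  obtain ⟨κ, hκ, z, hz⟩ := hN₀ m
  have hfactor (k : ℕ) : IsUnit (algebraMap (W p)[X] (LocRing (hab.wittPoly N))
      (PowerSeries.trunc p (hab.wittF (κ k)))) :=
    isUnit_of_dvd_unit (map_dvd _ <| Finset.dvd_prod_of_mem
        (fun i => PowerSeries.trunc p (hab.wittF i))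
        (Finset.mem_range_succ_iff.2 ((hκ k).trans hN)))
      (IsLocalization.Away.algebraMap_isUnit (hab.wittPoly N))
  have hprod : IsUnit (algebraMap (W p)[X] (LocRing (hab.wittPoly N))
      (∏ k ∈ Finset.range m, PowerSeries.trunc p (hab.wittF (κ k)) ^ p ^ k)) := by
    simp only [map_prod, map_pow]
    exact IsUnit.prod_iff.2 fun k _ => (hfactor k).pow _
  rw [sub_eq_iff_eq_add.1 hz, map_add, map_mul, map_natCast]
  exact (isCoprime_one_left.of_isCoprime_of_dvd_left hprod.dvd).mul_add_left_left _

theorem exists_map_eq_hypG_and_map_eq_hypLog (w : W p) :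
    ∃ G 𝓕 : PowerSeries (W p),
      PowerSeries.map (algebraMap (W p) (K p)) G = hypG a b (1 + p * w) ∧
      PowerSeries.map (algebraMap (W p) (K p)) 𝓕 = hypLog a b (1 + p * w) ∧
      ∀ n, (p : PowerSeries (W p)) ^ n ∣ (PowerSeries.trunc (p ^ (n + 1)) G : PowerSeries (W p))
        - 𝓕 * (PowerSeries.trunc (p ^ (n + 1)) (hab.wittF 0) : PowerSeries (W p)) := by
  obtain ⟨q, hq, hG⟩ := hab.exists_map_eq_hypG w
  obtain ⟨U, hU⟩ := (PowerSeries.isUnit_iff_constantCoeff (φ := hab.wittF 0)).2 <| by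
    rw [hab.constantCoeff_wittF]; exact isUnit_one
  refine ⟨_, PowerSeries.mk (fun k => q k * hab.wittCoeff 0 (State.empty b) k) * U⁻¹.val, hG,
    ?_, fun n => ?_⟩
  · have hF : PowerSeries.constantCoeff (hypF a b 0) ≠ 0 := by
      rw [← hab.map_wittF, ← PowerSeries.coeff_zero_eq_constantCoeff_apply, PowerSeries.coeff_map,
        PowerSeries.coeff_zero_eq_constantCoeff_apply, hab.constantCoeff_wittF, map_one]
      exact one_ne_zero
    rw [hypLog, PowerSeries.eq_mul_inv_iff_mul_eq hF, ← hab.map_wittF, ← map_mul, ← hG, mul_assoc,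
      ← hU, Units.inv_mul, mul_one]
  · have hcross := natCast_pow_dvd_powerSeries_iff.2
      (hab.isDworkSystem_wittCoeff.pow_dvd_coeff_mul_trunc_sub
        (natCast_W_ne_zero p (Fact.out : p.Prime).ne_zero) hq 0 n)
    rw [dvd_sub_comm, mul_comm (PowerSeries.mk (hab.wittCoeff _ _))] at hcross
    rw [← U.isUnit.dvd_mul_right, sub_mul, mul_right_comm, mul_assoc _ U⁻¹.val, Units.inv_mul,
      mul_one, hU]
    exact hcross

end DigitConditions

end LogHypergeometric

theorem corollary3p4_general (p : ℕ) [Fact p.Prime] {r : ℕ}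
    (a : Fin (r + 1) → ℤ_[p]) (b : Fin r → ℤ_[p]) (hab : DigitConditions a b) :
    ∃ N₀ : ℕ, ∀ N : ℕ, N₀ ≤ N →
      ∃ h : (W p)[X], h.map (algebraMap (W p) (K p)) = hypPoly a b N ∧
      ∃ hu : IsUnit (h : PowerSeries (W p)),
      ∀ c : W p, (∃ w : W p, c = 1 + p * w) →
        ∃ 𝓕 : PowerSeries (W p),
          PowerSeries.map (algebraMap (W p) (K p)) 𝓕 = hypLog a b c ∧
          ∃ f : TateAlg h,
            (∀ f' : TateAlg h, IsImage (toSeries h hu) f' 𝓕 ↔ f' = f) ∧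
            ∀ α : W p, padicAbs p (algebraMap (W p) (K p) (h.eval α)) = 1 →
              ∃ hα : IsUnit (h.eval α),
              ∃ v : W p,
                (∀ v' : W p, IsImage (evalAt h α hα) f v' ↔ v' = v) ∧
                (∀ n : ℕ, (PowerSeries.trunc (p ^ n) (hypF a b 0)).eval
                  (algebraMap (W p) (K p) α) ≠ 0) ∧
                IsPadicLimit p
                  (fun n => (PowerSeries.trunc (p ^ n) (hypG a b c)).eval
                      (algebraMap (W p) (K p) α) /
                    (PowerSeries.trunc (p ^ n) (hypF a b 0)).eval
                      (algebraMap (W p) (K p) α))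
                  (algebraMap (W p) (K p) v) := by
  obtain ⟨N₀, hN₀⟩ := hab.exists_isCoprime_trunc_wittF
  refine ⟨N₀, fun N hN => ⟨hab.wittPoly N, hab.map_wittPoly N, hab.isUnit_wittPoly N, ?_⟩⟩
  rintro c ⟨w, rfl⟩
  obtain ⟨G, 𝓕, hG, h𝓕, hcong⟩ := hab.exists_map_eq_hypG_and_map_eq_hypLog w
  obtain ⟨f, hf⟩ := exists_isImage_toSeries_iff_eq (hab.isUnit_wittPoly N) fun n =>
    exists_pow_dvd_toSeries_sub _ (hN₀ N hN (n + 1)) (hcong n)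
  refine ⟨𝓕, h𝓕, f, hf, fun α hα₁ => ?_⟩
  have hα := isUnit_of_padicAbs_eq_one hα₁
  obtain ⟨v, hv⟩ := exists_isImage_iff_eq (evalAt (hab.wittPoly N) α hα) f
  have hunit (n : ℕ) : IsUnit ((PowerSeries.trunc (p ^ n) (hab.wittF 0)).eval α) := by
    have h := (hN₀ N hN n).map (evalAt _ α hα)
    rw [evalAt_algebraMap, map_natCast] at h
    exact isUnit_of_isCoprime_natCast h
  simp only [← hG, ← hab.map_wittF, eval_trunc_map]
  refine ⟨hα, v, hv, fun n => ((hunit n).map _).ne_zero, isPadicLimit_div hunit fun n => ?_⟩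
  simpa only [evalAt_algebraMap] using ((hf f).2 rfl).pow_dvd_sub_mul ((hv v).2 rfl) (hcong n)

theorem corollary3p4 (p : ℕ) [Fact p.Prime] {r : ℕ}
    (a : Fin (r + 1) → ℤ_[p]) (b : Fin r → ℤ_[p]) (hab : Admissible a b) :
    ∃ N₀ : ℕ, ∀ N : ℕ, N₀ ≤ N →
      ∃ h : (W p)[X], h.map (algebraMap (W p) (K p)) = hypPoly a b N ∧
      ∃ hu : IsUnit (h : PowerSeries (W p)),
      ∀ c : W p, (∃ w : W p, c = 1 + p * w) →
        ∃ 𝓕 : PowerSeries (W p),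
          PowerSeries.map (algebraMap (W p) (K p)) 𝓕 = hypLog a b c ∧
          ∃ f : TateAlg h,
            (∀ f' : TateAlg h, IsImage (toSeries h hu) f' 𝓕 ↔ f' = f) ∧
            ∀ α : W p, padicAbs p (algebraMap (W p) (K p) (h.eval α)) = 1 →
              ∃ hα : IsUnit (h.eval α),
              ∃ v : W p,
                (∀ v' : W p, IsImage (evalAt h α hα) f v' ↔ v' = v) ∧
                (∀ n : ℕ, (PowerSeries.trunc (p ^ n) (hypF a b 0)).eval
                  (algebraMap (W p) (K p) α) ≠ 0) ∧
                IsPadicLimit p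
                  (fun n => (PowerSeries.trunc (p ^ n) (hypG a b c)).eval
                      (algebraMap (W p) (K p) α) /
                    (PowerSeries.trunc (p ^ n) (hypF a b 0)).eval
                      (algebraMap (W p) (K p) α))
                  (algebraMap (W p) (K p) v) :=
  corollary3p4_general p a b ⟨hab.norm_b, hab.digits⟩
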